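/- Let $u_0,u_1:\mathbb R^n\to\mathbb R$ be functions such that $u_0$ has generalized (weak) partial derivatives of all integer orders $k\le \frac n2+3$ that are square integrable on each bounded set, and $u_1$ has generalized partial derivatives of all integer orders $k\le\frac n2+2$ that are square integrable on each bounded set. (Order $k=0$ is included, i.e. $u_0$ and $u_1$ themselves are square integrable on bounded sets. A function $g$ that is square integrable on bounded sets is the generalized derivative $\partial_{i_1}\cdots\partial_{i_k}f$ if $\int f\,\partial_{i_1}\cdots\partial_{i_k}\varphi\,dx=(-1)^k\int g\,\varphi\,dx$ for all $\varphi\in C_c^\infty(\mathbb R^n)$.) Then there is a function $u=u(x,t)$, twice continuously differentiable on all of $\mathbb R^n\times\mathbb R$, such that $$\Delta u-\frac{\partial^2u}{\partial t^2}=0\quad\text{on }\mathbb R^n\times\mathbb R,\qquad u|_{t=0}=u_0,\qquad \frac{\partial u}{\partial t}\Big|_{t=0}=u_1,$$ where $\Delta$ is the Laplacian in $x\in\mathbb R^n$ and the two initial conditions hold almost everywhere on $\mathbb R^n$ (the functions $u_0,u_1$ being determined only up to null sets). -/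

import Mathlib

open MeasureTheory InnerProductSpace Laplacian
open scoped ContDiff

noncomputable section

/-- The classical iterated partial derivative `∂_{i 0} ∂_{i 1} ⋯ ∂_{i (k-1)} φ` of order `k` of a
function on `ℝⁿ`. As `i` ranges over all maps `Fin k → Fin n`, this gives all partial derivatives of
order exactly `k`; for `k = 0` it is `φ` itself. -/
def partialDerivative {n k : ℕ} (i : Fin k → Fin n) (φ : EuclideanSpace ℝ (Fin n) → ℝ) :
    EuclideanSpace ℝ (Fin n) → ℝ :=
  fun x => iteratedFDeriv ℝ k φ x (fun j => EuclideanSpace.single (i j) (1 : ℝ))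

/-- `g` is the generalized (weak) partial derivative `∂_{i 0} ⋯ ∂_{i (k-1)} f` on `ℝⁿ`: integration
by parts holds against every smooth compactly supported test function. This is meant for locally
integrable `f` and `g`. -/
def IsGeneralizedDerivative {n k : ℕ} (i : Fin k → Fin n)
    (f g : EuclideanSpace ℝ (Fin n) → ℝ) : Prop :=
  ∀ φ : EuclideanSpace ℝ (Fin n) → ℝ, ContDiff ℝ ∞ φ → HasCompactSupport φ →
    ∫ x, f x * partialDerivative i φ x = (-1 : ℝ) ^ k * ∫ x, g x * φ x

/-- `f` is (measurable and) square integrable on each bounded subset of `ℝⁿ`. -/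
def SquareIntegrableOnBounded {n : ℕ} (f : EuclideanSpace ℝ (Fin n) → ℝ) : Prop :=
  ∀ B : Set (EuclideanSpace ℝ (Fin n)), Bornology.IsBounded B → MemLp f 2 (volume.restrict B)

/-- `f` has generalized derivatives of all orders up to `s` that are square integrable on each
bounded set. The order `k` of a derivative is a natural number, and all `k ≤ s` are meant,
including `k = 0`, that is, `f` itself. -/
def HasSquareIntegrableDerivativesUpTo {n : ℕ} (s : ℝ) (f : EuclideanSpace ℝ (Fin n) → ℝ) : Prop :=
  SquareIntegrableOnBounded f ∧
    ∀ k : ℕ, (k : ℝ) ≤ s → ∀ i : Fin k → Fin n,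
      ∃ g : EuclideanSpace ℝ (Fin n) → ℝ,
        SquareIntegrableOnBounded g ∧ IsGeneralizedDerivative i f g

/-- The wave operator `□u = Δu - ∂²u/∂t²` on functions of `(x, t) ∈ ℝⁿ × ℝ`, where `Δ` is the
Laplacian in the space variable `x`. -/
def waveOperator {n : ℕ} (u : EuclideanSpace ℝ (Fin n) × ℝ → ℝ) :
    EuclideanSpace ℝ (Fin n) × ℝ → ℝ :=
  fun p => (Δ (fun y => u (y, p.2))) p.1 - iteratedDeriv 2 (fun s => u (p.1, s)) p.2

end

open Topology Set Filter

variable {n : ℕ}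

local notation "𝔼" => EuclideanSpace ℝ (Fin n)

/-! Existence comes from the Fourier transform after cutting off the data, and uniqueness from
energy estimates then allows the local solutions to be glued.

If `ψ` is a smooth cutoff equal to 1 on a ball, `ψ u₀` has square integrable weak derivatives up to
order `⌊n/2⌋ + 3`, so `(1 + ‖ξ‖) ^ (⌊n/2⌋ + 3)` times its transform `a` lies in `L²`
(`CompactSobolev.memLp_weight`). Since `(1 + ‖ξ‖) ^ (-(⌊n/2⌋ + 1))` is also in `L²`, Cauchy–Schwarz
makes `(1 + ‖ξ‖) ^ 2 * a` integrable; likewise `(1 + ‖ξ‖) * b` for the transform `b` of `ψ u₁`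
(`CompactSobolev.integrable_weight`). The superposition of plane waves with amplitudes `cos (2π‖ξ‖t)
a + sin (2π‖ξ‖t) / (2π‖ξ‖) b` can then be differentiated twice under the integral. It solves the
wave equation, and Fourier inversion recovers the cut-off data almost everywhere
(`exists_wave_solution_on_ball`).

Signals travel with speed at most one: the energy in a shrinking backward cone does not increase, so
data vanishing on a ball of radius `R` force the solution to vanish where `‖x‖ + |t| < R`
(`eq_zero_of_cauchyData_eq_zero`). Hence the solutions built from different cutoffs agree on common
double cones and define one global solution. -/

/-! ### Slices and the wave operator in terms of space-time derivatives -/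

theorem fderiv_fderiv_apply_const {V W : Type*} [NormedAddCommGroup V] [NormedSpace ℝ V]
    [NormedAddCommGroup W] [NormedSpace ℝ W] {f : V → W} (hf : ContDiff ℝ 2 f) (x v w : V) :
    fderiv ℝ (fun y => fderiv ℝ f y v) x w = fderiv ℝ (fderiv ℝ f) x w v := by
  have h : DifferentiableAt ℝ (fderiv ℝ f) x :=
    ((hf.fderiv_right (m := 1) le_rfl).differentiable one_ne_zero) x
  have := (h.hasFDerivAt.clm_apply (hasFDerivAt_const v x)).fderiv
  rw [this]; simp

theorem ContDiff.fderiv_apply_const {V W : Type*} [NormedAddCommGroup V] [NormedSpace ℝ V]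
    [NormedAddCommGroup W] [NormedSpace ℝ W] {f : V → W} (hf : ContDiff ℝ 2 f) (v : V) :
    ContDiff ℝ 1 (fun y => fderiv ℝ f y v) :=
  (hf.fderiv_right (m := 1) le_rfl).clm_apply contDiff_const

theorem fderiv_slice_fst {V W G : Type*} [NormedAddCommGroup V] [NormedSpace ℝ V]
    [NormedAddCommGroup W] [NormedSpace ℝ W] [NormedAddCommGroup G] [NormedSpace ℝ G]
    {f : V × W → G} {x : V} {t : W} (hf : DifferentiableAt ℝ f (x, t)) (v : V) :
    fderiv ℝ (fun y => f (y, t)) x v = fderiv ℝ f (x, t) (v, 0) := by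
  have := (HasFDerivAt.comp (g := f) (f := fun y => (y, t)) x hf.hasFDerivAt
    (hasFDerivAt_prodMk_left x t)).fderiv
  simp only [Function.comp_def] at this
  rw [this]; simp

theorem hasDerivAt_slice_snd {V G : Type*} [NormedAddCommGroup V] [NormedSpace ℝ V]
    [NormedAddCommGroup G] [NormedSpace ℝ G]
    {f : V × ℝ → G} {x : V} {t : ℝ} (hf : DifferentiableAt ℝ f (x, t)) :
    HasDerivAt (fun s => f (x, s)) (fderiv ℝ f (x, t) (0, 1)) t := by
  have := (HasFDerivAt.comp (g := f) (f := fun s => (x, s)) t hf.hasFDerivAt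
    (hasFDerivAt_prodMk_right x t)).hasDerivAt
  simpa [Function.comp_def] using this

/-- Iterated derivatives of slices become directional derivatives on the product space, where the
symmetry of second derivatives and the product rule apply directly. -/
theorem waveOperator_eq_fderiv {u : 𝔼 × ℝ → ℝ} (hu : ContDiff ℝ 2 u) (p : 𝔼 × ℝ) :
    waveOperator u p =
      ∑ k : Fin n, fderiv ℝ (fun q => fderiv ℝ u q (EuclideanSpace.single k 1, 0)) p
        (EuclideanSpace.single k 1, 0)
      - fderiv ℝ (fun q => fderiv ℝ u q (0, 1)) p (0, 1) := by
  obtain ⟨x, t⟩ := p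
  have hd : Differentiable ℝ u := hu.differentiable two_ne_zero
  have hs : ContDiff ℝ 2 (fun y => u (y, t)) := hu.comp (contDiff_id.prodMk contDiff_const)
  unfold waveOperator
  congr 1
  · rw [laplacian_eq_iteratedFDeriv_orthonormalBasis _ (EuclideanSpace.basisFun (Fin n) ℝ)]
    refine Finset.sum_congr rfl fun k _ => ?_
    rw [iteratedFDeriv_two_apply]
    simp only [EuclideanSpace.basisFun_apply, Matrix.cons_val_zero, Matrix.cons_val_one]
    rw [← fderiv_fderiv_apply_const hs]
    have : (fun y => fderiv ℝ (fun y => u (y, t)) y (EuclideanSpace.single k 1)) =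
        fun y => fderiv ℝ u (y, t) (EuclideanSpace.single k 1, 0) := by
      ext y; exact fderiv_slice_fst (hd _) _
    rw [this]
    exact fderiv_slice_fst (f := fun q => fderiv ℝ u q (EuclideanSpace.single k 1, 0))
      ((hu.fderiv_apply_const _).differentiable one_ne_zero _) _
  · rw [iteratedDeriv_succ, iteratedDeriv_one]
    have : deriv (fun s => u (x, s)) = fun s => fderiv ℝ u (x, s) (0, 1) := by
      ext s; exact (hasDerivAt_slice_snd (hd _)).deriv
    simp only [this]
    exact (hasDerivAt_slice_snd (f := fun q => fderiv ℝ u q (0, 1))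
      ((hu.fderiv_apply_const _).differentiable one_ne_zero _)).deriv

/-! ### Integrals over time slices -/

theorem hasCompactSupport_slice {F : 𝔼 × ℝ → ℝ} {R : ℝ}
    (hR : ∀ x t, F (x, t) ≠ 0 → ‖x‖ + t < R) (t : ℝ) :
    HasCompactSupport (fun x => F (x, t)) := by
  refine HasCompactSupport.of_support_subset_isCompact
    (isCompact_closedBall (0 : 𝔼) (R - t)) fun x hx => ?_
  rw [mem_closedBall_zero_iff]
  have := hR x t hx
  linarith

/-- Each slice is compactly supported, although the support may grow without bound as time goes to
`-∞`; the derivative is therefore dominated only locally in time. -/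
theorem hasDerivAt_integral_slice {F : 𝔼 × ℝ → ℝ} {R : ℝ} (hF : ContDiff ℝ 1 F)
    (hR : ∀ x t, F (x, t) ≠ 0 → ‖x‖ + t < R) (t : ℝ) :
    HasDerivAt (fun t => ∫ x, F (x, t)) (∫ x, fderiv ℝ F (x, t) (0, 1)) t := by
  have hd : Differentiable ℝ F := hF.differentiable one_ne_zero
  have hl : ∀ s : ℝ, Continuous fun x : 𝔼 => (x, s) := fun s => by fun_prop
  have hc : Continuous (fun p : 𝔼 × ℝ => fderiv ℝ F p (0, 1)) :=
    (hF.continuous_fderiv one_ne_zero).clm_apply continuous_const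
  -- At every time later than `t - 1` the slice is supported in the ball of radius `R - t + 1`.
  obtain ⟨C, hC⟩ := ((isCompact_closedBall (0 : 𝔼) (R - t + 1)).prod
    (isCompact_closedBall t 1)).exists_bound_of_continuousOn hc.continuousOn
  refine (hasDerivAt_integral_of_dominated_loc_of_deriv_le (Metric.ball_mem_nhds t one_pos)
    (F := fun t x => F (x, t)) (F' := fun t x => fderiv ℝ F (x, t) (0, 1))
    (bound := (Metric.closedBall (0 : 𝔼) (R - t + 1)).indicator fun _ => C)
    (Eventually.of_forall fun s => ?_) ?_ ?_ ?_ ?_ ?_).2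
  · exact (hF.continuous.comp (hl _)).aestronglyMeasurable
  · exact (hF.continuous.comp (hl _)).integrable_of_hasCompactSupport
      (hasCompactSupport_slice hR t)
  · exact (hc.comp (hl t)).aestronglyMeasurable
  · refine Eventually.of_forall fun x s hs => ?_
    by_cases hx : x ∈ Metric.closedBall (0 : 𝔼) (R - t + 1)
    · rw [indicator_of_mem hx]
      exact hC (x, s) ⟨hx, Metric.ball_subset_closedBall hs⟩
    · rw [indicator_of_notMem hx]
      rw [mem_closedBall_zero_iff, not_le] at hx
      -- The support condition concerns `F` alone; its time derivative vanishes here because `F (x,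
      -- ·)` is zero near `s`.
      have h0 : (fun s => F (x, s)) =ᶠ[𝓝 s] fun _ => 0 := by
        filter_upwards [Metric.isOpen_ball.mem_nhds hs] with r hr
        by_contra h
        have := hR x r h
        rw [Metric.mem_ball, Real.dist_eq, abs_lt] at hr
        linarith
      have := ((hasDerivAt_slice_snd (hd (x, s))).congr_of_eventuallyEq h0.symm).unique
        (hasDerivAt_const s 0)
      rw [this, norm_zero]
  · rw [integrable_indicator_iff Metric.isClosed_closedBall.measurableSet]
    exact integrableOn_const (isCompact_closedBall _ _).measure_lt_top.ne
  · exact Eventually.of_forall fun x s _ => hasDerivAt_slice_snd (hd (x, s))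

theorem integral_fderiv_slice_eq_zero {F : 𝔼 × ℝ → ℝ} {R : ℝ} (hF : ContDiff ℝ 1 F)
    (hR : ∀ x t, F (x, t) ≠ 0 → ‖x‖ + t < R) (t : ℝ) (v : 𝔼) :
    Integrable (fun x => fderiv ℝ F (x, t) (v, 0)) ∧
      ∫ x, fderiv ℝ F (x, t) (v, 0) = 0 := by
  have hd : Differentiable ℝ F := hF.differentiable one_ne_zero
  have hs : ContDiff ℝ 1 (fun x => F (x, t)) := hF.comp (contDiff_id.prodMk contDiff_const)
  have hcs := hasCompactSupport_slice hR t
  have e : (fun x => fderiv ℝ F (x, t) (v, 0)) = fun x => fderiv ℝ (fun x => F (x, t)) x v := by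
    ext x; exact (fderiv_slice_fst (hd _) v).symm
  rw [e]
  have hi : Integrable (fun x => fderiv ℝ (fun x => F (x, t)) x v) :=
    ((hs.continuous_fderiv one_ne_zero).clm_apply
      continuous_const).integrable_of_hasCompactSupport
      ((hcs.fderiv (𝕜 := ℝ)).comp_left (g := fun L : 𝔼 →L[ℝ] ℝ => L v) rfl)
  refine ⟨hi, ?_⟩
  -- Integration by parts against the constant function 1.
  have := integral_mul_fderiv_eq_neg_fderiv_mul_of_integrable (μ := (volume : Measure 𝔼))
    (f := fun _ => (1 : ℝ)) (g := fun x => F (x, t)) (v := v) (by simp) (by simpa using hi)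
    (by simpa using hs.continuous.integrable_of_hasCompactSupport hcs)
    (fun _ _ => differentiableAt_const _) (fun x _ => (hs.differentiable one_ne_zero) x)
  simpa using this

/-! ### The energy method and domains of dependence -/

theorem contDiff_sqrt_norm_sq_add {ε : ℝ} (hε : 0 < ε) {m : ℕ∞} :
    ContDiff ℝ m (fun x : 𝔼 => √(‖x‖ ^ 2 + ε ^ 2)) :=
  ((contDiff_norm_sq ℝ).add contDiff_const).sqrt fun x => by positivity

/-- The gradient is `x / √(‖x‖² + ε²)`, of length less than 1. This is the unit speed limit: the
level sets of the smoothed cone are spacelike. -/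
theorem sum_sq_fderiv_sqrt_norm_sq_add_le {ε : ℝ} (hε : 0 < ε) (x : 𝔼) :
    ∑ k, (fderiv ℝ (fun x : 𝔼 => √(‖x‖ ^ 2 + ε ^ 2)) x (EuclideanSpace.single k 1)) ^ 2 ≤ 1 := by
  have hp : 0 < ‖x‖ ^ 2 + ε ^ 2 := by positivity
  have h1 : HasFDerivAt (fun x : 𝔼 => ‖x‖ ^ 2 + ε ^ 2) (2 • innerSL ℝ x) x :=
    (hasStrictFDerivAt_norm_sq x).hasFDerivAt.add_const _
  have h2 := h1.sqrt hp.ne'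
  rw [h2.fderiv]
  have h3 : ∀ k, ((1 / (2 * √(‖x‖ ^ 2 + ε ^ 2))) • (2 • innerSL ℝ x))
      (EuclideanSpace.single k (1 : ℝ)) = x k / √(‖x‖ ^ 2 + ε ^ 2) := by
    intro k
    simp [EuclideanSpace.inner_single_right]
    field_simp
  simp only [h3, div_pow, Real.sq_sqrt hp.le]
  rw [← Finset.sum_div, div_le_one hp, EuclideanSpace.norm_sq_eq]
  simp only [Real.norm_eq_abs, sq_abs]
  nlinarith

/-- The cutoff used in the energy method: it is positive exactly on a smoothed backward cone. -/
noncomputable def coneCutoff (n : ℕ) (R ε : ℝ) (p : EuclideanSpace ℝ (Fin n) × ℝ) : ℝ :=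
  expNegInvGlue (R - √(‖p.1‖ ^ 2 + ε ^ 2) - p.2)

theorem contDiff_coneCutoff (R : ℝ) {ε : ℝ} (hε : 0 < ε) : ContDiff ℝ 1 (coneCutoff n R ε) :=
  (expNegInvGlue.contDiff (n := 1)).comp
    ((contDiff_const.sub ((contDiff_sqrt_norm_sq_add hε (m := 1)).comp contDiff_fst)).sub
      contDiff_snd)

theorem fderiv_coneCutoff (R : ℝ) {ε : ℝ} (hε : 0 < ε) (p v : 𝔼 × ℝ) :
    fderiv ℝ (coneCutoff n R ε) p v =
      deriv expNegInvGlue (R - √(‖p.1‖ ^ 2 + ε ^ 2) - p.2) *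
        (- fderiv ℝ (fun x : 𝔼 => √(‖x‖ ^ 2 + ε ^ 2)) p.1 v.1 - v.2) := by
  have h1 : HasFDerivAt (fun x : 𝔼 => √(‖x‖ ^ 2 + ε ^ 2)) _ p.1 :=
    ((contDiff_sqrt_norm_sq_add hε (m := 1)).differentiable (by simp) p.1).hasFDerivAt
  have h2 : HasFDerivAt (fun p : 𝔼 × ℝ => R - √(‖p.1‖ ^ 2 + ε ^ 2) - p.2) _ p :=
    ((HasFDerivAt.comp (g := fun x : 𝔼 => √(‖x‖ ^ 2 + ε ^ 2)) p h1
      hasFDerivAt_fst).const_sub R).sub hasFDerivAt_snd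
  have h3 : HasDerivAt expNegInvGlue (deriv expNegInvGlue (R - √(‖p.1‖ ^ 2 + ε ^ 2) - p.2))
      (R - √(‖p.1‖ ^ 2 + ε ^ 2) - p.2) :=
    ((expNegInvGlue.contDiff (n := 1)).differentiable (by simp) _).hasDerivAt
  have h4 : HasFDerivAt (coneCutoff n R ε) _ p := h3.comp_hasFDerivAt p h2
  rw [h4.fderiv]
  simp

/-- This and `coneCutoff_pos` rest on `‖x‖ ≤ √(‖x‖² + ε²) ≤ ‖x‖ + ε`: the smoothed cone lies inside
the true one and misses it by at most `ε`. -/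
theorem lt_of_coneCutoff_ne_zero {R ε : ℝ} {x : 𝔼} {t : ℝ}
    (h : coneCutoff n R ε (x, t) ≠ 0) : ‖x‖ + t < R := by
  by_contra hc
  refine h (expNegInvGlue.zero_of_nonpos ?_)
  have : ‖x‖ ≤ √(‖x‖ ^ 2 + ε ^ 2) := Real.le_sqrt_of_sq_le (by nlinarith [sq_nonneg ε])
  simp only
  linarith

theorem coneCutoff_pos {R ε : ℝ} (hε : 0 < ε) {x : 𝔼} {t : ℝ}
    (h : ‖x‖ + t + ε < R) : 0 < coneCutoff n R ε (x, t) := by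
  refine expNegInvGlue.pos_of_pos ?_
  have : √(‖x‖ ^ 2 + ε ^ 2) ≤ ‖x‖ + ε :=
    Real.sqrt_le_iff.2 ⟨by positivity, by nlinarith [norm_nonneg x]⟩
  simp only
  linarith

/-- The energy density of a function on space-time. -/
noncomputable def energyDensity (w : EuclideanSpace ℝ (Fin n) × ℝ → ℝ)
    (p : EuclideanSpace ℝ (Fin n) × ℝ) : ℝ :=
  (fderiv ℝ w p (0, 1) ^ 2 + ∑ k : Fin n, fderiv ℝ w p (EuclideanSpace.single k 1, 0) ^ 2) / 2

theorem contDiff_energyDensity {w : 𝔼 × ℝ → ℝ} (hw : ContDiff ℝ 2 w) :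
    ContDiff ℝ 1 (energyDensity w) :=
  (((hw.fderiv_apply_const _).pow 2).add
    (ContDiff.sum fun _ _ => (hw.fderiv_apply_const _).pow 2)).div_const 2

/-- The local energy identity for solutions of the wave equation, with a cutoff. -/
theorem fderiv_cutoff_mul_energyDensity {w χ : 𝔼 × ℝ → ℝ} (hw : ContDiff ℝ 2 w)
    (hχ : ContDiff ℝ 1 χ) (hwave : ∀ p, waveOperator w p = 0) (p : 𝔼 × ℝ) :
    fderiv ℝ (fun q => χ q * energyDensity w q) p (0, 1) =
      fderiv ℝ χ p (0, 1) * energyDensity w p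
      - ∑ k : Fin n, fderiv ℝ χ p (EuclideanSpace.single k 1, 0) *
          (fderiv ℝ w p (0, 1) * fderiv ℝ w p (EuclideanSpace.single k 1, 0))
      + ∑ k : Fin n, fderiv ℝ (fun q => χ q *
          (fderiv ℝ w q (0, 1) * fderiv ℝ w q (EuclideanSpace.single k 1, 0))) p
          (EuclideanSpace.single k 1, 0) := by
  have hχ' : HasFDerivAt χ _ p := (hχ.differentiable one_ne_zero p).hasFDerivAt
  have hv : ∀ v : 𝔼 × ℝ, HasFDerivAt (fun q => fderiv ℝ w q v)
      (fderiv ℝ (fun q => fderiv ℝ w q v) p) p := fun v =>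
    ((hw.fderiv_apply_const v).differentiable one_ne_zero p).hasFDerivAt
  have he : HasFDerivAt (energyDensity w) _ p :=
    (((hv (0, 1)).pow 2).add (HasFDerivAt.fun_sum (u := Finset.univ) fun k _ =>
      (hv (EuclideanSpace.single k 1, 0)).pow 2)).mul_const (2⁻¹ : ℝ)
  -- Symmetry of mixed derivatives, together with replacing `w_tt` by `Δw`, turns the time
  -- derivative of the energy density into the divergence of `w_t ∇w`.
  have hsym : ∀ k : Fin n, fderiv ℝ (fun q => fderiv ℝ w q (0, 1)) p
      (EuclideanSpace.single k 1, 0) =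
      fderiv ℝ (fun q => fderiv ℝ w q (EuclideanSpace.single k 1, 0)) p (0, 1) := by
    intro k
    rw [fderiv_fderiv_apply_const hw, fderiv_fderiv_apply_const hw]
    exact (hw.contDiffAt.isSymmSndFDerivAt (by simp)) _ _
  have hwv := hwave p
  rw [waveOperator_eq_fderiv hw, sub_eq_zero] at hwv
  have hG : ∀ k : Fin n, fderiv ℝ (fun q => χ q *
          (fderiv ℝ w q (0, 1) * fderiv ℝ w q (EuclideanSpace.single k 1, 0))) p
          (EuclideanSpace.single k 1, 0) =
      fderiv ℝ χ p (EuclideanSpace.single k 1, 0) *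
          (fderiv ℝ w p (0, 1) * fderiv ℝ w p (EuclideanSpace.single k 1, 0))
      + χ p * (fderiv ℝ (fun q => fderiv ℝ w q (EuclideanSpace.single k 1, 0)) p (0, 1) *
          fderiv ℝ w p (EuclideanSpace.single k 1, 0))
      + χ p * fderiv ℝ w p (0, 1) *
          fderiv ℝ (fun q => fderiv ℝ w q (EuclideanSpace.single k 1, 0)) p
            (EuclideanSpace.single k 1, 0) := by
    intro k
    rw [(hχ'.fun_mul ((hv (0, 1)).fun_mul (hv (EuclideanSpace.single k 1, 0)))).fderiv]
    simp [hsym]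
    ring
  rw [Finset.sum_congr rfl fun k _ => hG k, Finset.sum_add_distrib, Finset.sum_add_distrib,
    ← Finset.mul_sum, ← Finset.mul_sum, hwv, (hχ'.fun_mul he).fderiv]
  simp [mul_comm, mul_assoc, mul_left_comm, ← Finset.mul_sum]
  ring

/-- With `q` the gradient of the smoothed norm and `g ≥ 0`, the cutoff has time derivative `-g` and
space gradient `-g q`. The claim reduces to `q · (a b) ≤ (a² + |b|²) / 2`, which follows from `|q| ≤
1` and the arithmetic-geometric mean inequality. -/
theorem energy_flux_nonpos {w : 𝔼 × ℝ → ℝ} (R : ℝ) {ε : ℝ} (hε : 0 < ε) (p : 𝔼 × ℝ) :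
    fderiv ℝ (coneCutoff n R ε) p (0, 1) * energyDensity w p
      - ∑ k : Fin n, fderiv ℝ (coneCutoff n R ε) p (EuclideanSpace.single k 1, 0) *
          (fderiv ℝ w p (0, 1) * fderiv ℝ w p (EuclideanSpace.single k 1, 0)) ≤ 0 := by
  simp only [fderiv_coneCutoff R hε, map_zero, neg_zero, zero_sub, sub_zero]
  set g := deriv expNegInvGlue (R - √(‖p.1‖ ^ 2 + ε ^ 2) - p.2)
  have hg : 0 ≤ g := expNegInvGlue.monotone.deriv_nonneg
  have hq := sum_sq_fderiv_sqrt_norm_sq_add_le hε p.1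
  set q : Fin n → ℝ := fun k =>
    fderiv ℝ (fun x : 𝔼 => √(‖x‖ ^ 2 + ε ^ 2)) p.1 (EuclideanSpace.single k 1)
  set a := fderiv ℝ w p (0, 1)
  set b : Fin n → ℝ := fun k => fderiv ℝ w p (EuclideanSpace.single k 1, 0)
  have key : ∑ k, q k * (a * b k) ≤ energyDensity w p := by
    calc ∑ k, q k * (a * b k) ≤ ∑ k, (q k ^ 2 * a ^ 2 + b k ^ 2) / 2 :=
          Finset.sum_le_sum fun k _ => by nlinarith [sq_nonneg (q k * a - b k)]
      _ = ((∑ k, q k ^ 2) * a ^ 2 + ∑ k, b k ^ 2) / 2 := by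
          rw [← Finset.sum_div, Finset.sum_add_distrib, Finset.sum_mul]
      _ ≤ energyDensity w p := by
          unfold energyDensity
          change _ ≤ (a ^ 2 + ∑ k, b k ^ 2) / 2
          nlinarith [sq_nonneg a]
  have e : ∑ k, g * -q k * (a * b k) = - (g * ∑ k, q k * (a * b k)) := by
    rw [Finset.mul_sum, ← Finset.sum_neg_distrib]
    exact Finset.sum_congr rfl fun k _ => by ring
  change g * -1 * energyDensity w p - ∑ k, g * -q k * (a * b k) ≤ 0
  rw [e]
  nlinarith [mul_le_mul_of_nonneg_left key hg]

/-- Domain of dependence for the wave equation, forward in time. -/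
theorem eq_zero_of_cauchyData_eq_zero_forward {w : 𝔼 × ℝ → ℝ} {R : ℝ} (hw : ContDiff ℝ 2 w)
    (hwave : ∀ p, waveOperator w p = 0) (h0 : ∀ x, ‖x‖ < R → w (x, 0) = 0)
    (h1 : ∀ x, ‖x‖ < R → fderiv ℝ w (x, 0) (0, 1) = 0) {x : 𝔼} {t : ℝ} (ht : 0 ≤ t)
    (hx : ‖x‖ + t < R) : w (x, t) = 0 := by
  have hd : Differentiable ℝ w := hw.differentiable two_ne_zero
  -- The smoothing is small enough for the whole segment from `(x, 0)` to `(x, t)` to stay where the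
  -- cutoff is positive.
  obtain ⟨ε, hε, hεR⟩ : ∃ ε, 0 < ε ∧ ‖x‖ + t + ε < R :=
    ⟨(R - ‖x‖ - t) / 2, by linarith, by linarith⟩
  set χ := coneCutoff n R ε
  have hχ : ContDiff ℝ 1 χ := contDiff_coneCutoff R hε
  have hχ0 : ∀ p, 0 ≤ χ p := fun p => expNegInvGlue.nonneg _
  have he0 : ∀ p, 0 ≤ energyDensity w p := fun p => by unfold energyDensity; positivity
  set F : 𝔼 × ℝ → ℝ := fun q => χ q * energyDensity w q
  have hF : ContDiff ℝ 1 F := hχ.mul (contDiff_energyDensity hw)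
  have hFR : ∀ x t, F (x, t) ≠ 0 → ‖x‖ + t < R := fun x t h =>
    lt_of_coneCutoff_ne_zero (left_ne_zero_of_mul h)
  have hderiv := hasDerivAt_integral_slice hF hFR
  have hle : ∀ t, ∫ x, fderiv ℝ F (x, t) (0, 1) ≤ 0 := by
    intro t
    have hG := fun k : Fin n => integral_fderiv_slice_eq_zero (R := R) (F := fun q => χ q *
          (fderiv ℝ w q (0, 1) * fderiv ℝ w q (EuclideanSpace.single k 1, 0)))
        (hχ.mul ((hw.fderiv_apply_const _).mul (hw.fderiv_apply_const _)))
        (fun x t h => lt_of_coneCutoff_ne_zero (left_ne_zero_of_mul h)) t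
        (EuclideanSpace.single k 1)
    have hs : ∫ x, ∑ k : Fin n, fderiv ℝ (fun q => χ q *
          (fderiv ℝ w q (0, 1) * fderiv ℝ w q (EuclideanSpace.single k 1, 0))) (x, t)
          (EuclideanSpace.single k 1, 0) = 0 := by
      rw [integral_finsetSum _ fun k _ => (hG k).1]
      exact Finset.sum_eq_zero fun k _ => (hG k).2
    by_cases hi : Integrable fun x => fderiv ℝ F (x, t) (0, 1)
    · rw [← hs]
      refine integral_mono hi (integrable_finsetSum _ fun k _ => (hG k).1) fun x => ?_
      have h1 := fderiv_cutoff_mul_energyDensity hw hχ hwave (x, t)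
      have h2 := energy_flux_nonpos (w := w) R hε (x, t)
      simp only
      change fderiv ℝ (fun q => χ q * energyDensity w q) (x, t) (0, 1) ≤ _
      rw [h1]
      linarith
    -- The integral of a non-integrable function is 0 by convention, which satisfies the bound as
    -- well.
    · rw [integral_undef hi]
  have hanti : Antitone fun t => ∫ x, F (x, t) :=
    antitone_of_hasDerivAt_nonpos hderiv hle
  have hE0 : ∫ x, F (x, 0) = 0 := by
    refine integral_eq_zero_of_ae (Eventually.of_forall fun y => ?_)
    by_contra hy
    have hyR := hFR y 0 hy
    rw [add_zero] at hyR
    refine hy ?_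
    -- The initial value vanishes on an open ball, so its spatial derivatives vanish there too.
    have hz : ∀ v, fderiv ℝ w (y, 0) (v, 0) = 0 := by
      intro v
      rw [← fderiv_slice_fst (hd _)]
      have : (fun y => w (y, 0)) =ᶠ[𝓝 y] fun _ => 0 := by
        filter_upwards [(isOpen_lt continuous_norm continuous_const).mem_nhds hyR] with z hz
        exact h0 z hz
      rw [this.fderiv_eq]; simp
    simp [F, energyDensity, hz, h1 y hyR]
  -- The energy is nonnegative, nonincreasing and initially 0, so it stays 0. Its integrand is
  -- continuous and nonnegative, hence zero everywhere, and `w` is constant in time along the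
  -- segment.
  have hzero : ∀ s ∈ Icc 0 t, fderiv ℝ w (x, s) (0, 1) = 0 := by
    intro s hs
    have hc : Continuous fun x : 𝔼 => F (x, s) :=
      hF.continuous.comp (by fun_prop : Continuous fun x : 𝔼 => (x, s))
    have hI : ∫ x, F (x, s) = 0 :=
      le_antisymm ((hanti hs.1).trans hE0.le)
        (integral_nonneg fun y => mul_nonneg (hχ0 _) (he0 _))
    rw [integral_eq_zero_iff_of_nonneg (fun y => mul_nonneg (hχ0 _) (he0 _))
      (hc.integrable_of_hasCompactSupport (hasCompactSupport_slice hFR s))] at hI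
    have hF0 := congrFun ((hc.ae_eq_iff_eq volume continuous_const).1 hI) x
    have hpos : 0 < χ (x, s) := coneCutoff_pos hε (by linarith [hs.2])
    have : energyDensity w (x, s) = 0 := by
      rcases mul_eq_zero.1 hF0 with h | h
      · exact absurd h hpos.ne'
      · exact h
    unfold energyDensity at this
    have hn : 0 ≤ ∑ k : Fin n, fderiv ℝ w (x, s) (EuclideanSpace.single k 1, 0) ^ 2 := by
      positivity
    nlinarith [sq_nonneg (fderiv ℝ w (x, s) (0, 1))]
  have := constant_of_derivWithin_zero (f := fun s => w (x, s)) (a := 0) (b := t)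
    (fun s _ => (hasDerivAt_slice_snd (hd _)).differentiableAt.differentiableWithinAt)
    (fun s hs => by
      rw [((hasDerivAt_slice_snd (hd (x, s))).hasDerivWithinAt).derivWithin
        (uniqueDiffOn_Icc (hs.1.trans_lt hs.2) s (Ico_subset_Icc_self hs))]
      exact hzero s (Ico_subset_Icc_self hs)) t (right_mem_Icc.2 ht)
  rw [this]
  exact h0 x (by linarith)

/-- Only an even number of time derivatives occurs; reflection thus reduces negative times to
positive ones. -/
theorem waveOperator_comp_neg (w : 𝔼 × ℝ → ℝ) (p : 𝔼 × ℝ) :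
    waveOperator (fun q => w (q.1, -q.2)) p = waveOperator w (p.1, -p.2) := by
  unfold waveOperator
  simp only
  rw [iteratedDeriv_comp_neg 2 (fun s => w (p.1, s)) p.2]
  simp

/-- Domain of dependence for the wave equation. -/
theorem eq_zero_of_cauchyData_eq_zero {w : 𝔼 × ℝ → ℝ} {R : ℝ} (hw : ContDiff ℝ 2 w)
    (hwave : ∀ p, waveOperator w p = 0) (h0 : ∀ x, ‖x‖ < R → w (x, 0) = 0)
    (h1 : ∀ x, ‖x‖ < R → fderiv ℝ w (x, 0) (0, 1) = 0) {x : 𝔼} {t : ℝ}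
    (hx : ‖x‖ + |t| < R) : w (x, t) = 0 := by
  rcases le_total 0 t with ht | ht
  · exact eq_zero_of_cauchyData_eq_zero_forward hw hwave h0 h1 ht (by rwa [abs_of_nonneg ht] at hx)
  · have hw' : ContDiff ℝ 2 fun q : 𝔼 × ℝ => w (q.1, -q.2) :=
      hw.comp (contDiff_fst.prodMk contDiff_snd.neg)
    have := eq_zero_of_cauchyData_eq_zero_forward (R := R) hw'
      (fun p => by rw [waveOperator_comp_neg, hwave]) (fun x hx => by simpa using h0 x hx)
      (fun y hy => ?_) (x := x) (t := -t) (by linarith) (by rwa [abs_of_nonpos ht] at hx)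
    · simpa using this
    · have e1 := hasDerivAt_slice_snd (hw'.differentiable two_ne_zero (y, 0))
      have e2 := hasDerivAt_slice_snd (hw.differentiable two_ne_zero (y, -0))
      have e3 := (e2.scomp (0 : ℝ) (hasDerivAt_neg (0 : ℝ)))
      rw [e1.unique e3]
      simpa using h1 y hy

/-! ### Differentiating superpositions of plane waves -/

/-- A family of functions of the frequency, depending on time, whose growth in time is at most
linear and which is dominated by an integrable function of the frequency. -/
def DominatedFamily (h : EuclideanSpace ℝ (Fin n) → ℝ → ℂ) : Prop :=
  (∀ t, AEStronglyMeasurable (fun ξ => h ξ t) volume) ∧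
    ∃ M : EuclideanSpace ℝ (Fin n) → ℝ, Integrable M ∧ ∀ ξ t, ‖h ξ t‖ ≤ (1 + |t|) * M ξ

/-- The plane wave `e^{2πi⟨ξ, x⟩}`. -/
noncomputable def planeWave (ξ x : EuclideanSpace ℝ (Fin n)) : ℂ :=
  Complex.exp ((2 * Real.pi * inner ℝ ξ x : ℝ) * Complex.I)

/-- The superposition of plane waves with time-dependent amplitudes `h`. -/
noncomputable def waveSuperposition (h : EuclideanSpace ℝ (Fin n) → ℝ → ℂ)
    (p : EuclideanSpace ℝ (Fin n) × ℝ) : ℂ :=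
  ∫ ξ, planeWave ξ p.1 * h ξ p.2

/-- The Fourier symbol of the `k`-th partial derivative. -/
noncomputable def derivSymbol (k : Fin n) (ξ : EuclideanSpace ℝ (Fin n)) : ℂ :=
  (2 * Real.pi * ξ k : ℝ) * Complex.I

@[simp] theorem norm_planeWave (ξ x : 𝔼) : ‖planeWave ξ x‖ = 1 :=
  Complex.norm_exp_ofReal_mul_I _

theorem continuous_planeWave : Continuous fun q : 𝔼 × 𝔼 => planeWave q.1 q.2 := by
  unfold planeWave
  fun_prop

theorem DominatedFamily.integrable {h : 𝔼 → ℝ → ℂ} (hh : DominatedFamily h) (p : 𝔼 × ℝ) :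
    Integrable fun ξ => planeWave ξ p.1 * h ξ p.2 := by
  obtain ⟨hm, M, hM, hb⟩ := hh
  refine (hM.const_mul (1 + |p.2|)).mono' ((continuous_planeWave.comp
    (by fun_prop : Continuous fun ξ : 𝔼 => (ξ, p.1))).aestronglyMeasurable.mul (hm _)) ?_
  exact Eventually.of_forall fun ξ => by simpa using hb ξ p.2

theorem DominatedFamily.continuous {h : 𝔼 → ℝ → ℂ} (hh : DominatedFamily h)
    (hc : ∀ ξ, Continuous (h ξ)) : Continuous (waveSuperposition h) := by
  have hi := hh.integrable
  obtain ⟨hm, M, hM, hb⟩ := hh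
  rw [continuous_iff_continuousAt]
  intro p
  refine continuousAt_of_dominated (bound := fun ξ => (2 + |p.2|) * M ξ)
    (Eventually.of_forall fun q => (hi q).aestronglyMeasurable) ?_ (hM.const_mul _) ?_
  · have : ∀ᶠ q : 𝔼 × ℝ in 𝓝 p, |q.2| < |p.2| + 1 :=
      (isOpen_lt (by fun_prop) continuous_const).mem_nhds (by simp)
    filter_upwards [this] with q hq
    refine Eventually.of_forall fun ξ => ?_
    have h0 : 0 ≤ M ξ := by
      have := (norm_nonneg _).trans (hb ξ 0)
      simpa using this
    rw [norm_mul, norm_planeWave, one_mul]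
    exact (hb ξ q.2).trans (mul_le_mul_of_nonneg_right (by linarith) h0)
  · refine Eventually.of_forall fun ξ => Continuous.continuousAt ?_
    exact (continuous_planeWave.comp (by fun_prop : Continuous fun q : 𝔼 × ℝ => (ξ, q.1))).mul
      ((hc ξ).comp continuous_snd)

/-- The coordinate functional `(x, t) ↦ x k` on space-time. -/
noncomputable def spaceCoord (k : Fin n) : EuclideanSpace ℝ (Fin n) × ℝ →L[ℝ] ℝ :=
  (EuclideanSpace.proj k).comp (ContinuousLinearMap.fst ℝ _ _)

/-- The coordinate functional `(x, t) ↦ t` on space-time. -/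
noncomputable def timeCoord : EuclideanSpace ℝ (Fin n) × ℝ →L[ℝ] ℝ :=
  ContinuousLinearMap.snd ℝ _ _

/-- The derivative is written as a sum of coordinate functionals times amplitudes, so that
integrating it over `ξ` yields superpositions of the same kind. -/
theorem hasFDerivAt_planeWave_mul {h : ℝ → ℂ} {h' : ℂ} (ξ : 𝔼) (p : 𝔼 × ℝ)
    (hd : HasDerivAt h h' p.2) :
    HasFDerivAt (fun q : 𝔼 × ℝ => planeWave ξ q.1 * h q.2)
      (∑ k, (spaceCoord k).smulRight (planeWave ξ p.1 * (derivSymbol k ξ * h p.2)) +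
        timeCoord.smulRight (planeWave ξ p.1 * h')) p := by
  have h1 : HasFDerivAt (fun q : 𝔼 × ℝ => 2 * Real.pi * inner ℝ ξ q.1)
      ((2 * Real.pi) • (innerSL ℝ ξ).comp (ContinuousLinearMap.fst ℝ 𝔼 ℝ)) p :=
    (((innerSL ℝ ξ).comp (ContinuousLinearMap.fst ℝ 𝔼 ℝ)).hasFDerivAt).const_mul _
  have h2 : HasFDerivAt (fun q : 𝔼 × ℝ => ((2 * Real.pi * inner ℝ ξ q.1 : ℝ) : ℂ)) _ p :=
    (Complex.ofRealCLM.hasFDerivAt).comp p h1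
  have h3 := (h2.mul_const Complex.I).cexp
  have h4 : HasFDerivAt (fun q : 𝔼 × ℝ => h q.2) _ p :=
    HasFDerivAt.comp p hd.hasFDerivAt hasFDerivAt_snd
  have h5 := h3.fun_mul h4
  refine h5.congr_fderiv ?_
  ext v
  · have : (inner ℝ ξ v : ℝ) = ∑ k, ξ k * v k := by
      simp [PiLp.inner_apply, mul_comm]
    simp [spaceCoord, timeCoord, derivSymbol, planeWave, this, Finset.mul_sum]
    refine Finset.sum_congr rfl fun k _ => by ring
  · simp [spaceCoord, timeCoord, planeWave]

theorem hasFDerivAt_waveSuperposition {h h' : 𝔼 → ℝ → ℂ} (hh : DominatedFamily h)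
    (hh' : DominatedFamily h') (hk : ∀ k, DominatedFamily fun ξ t => derivSymbol k ξ * h ξ t)
    (hd : ∀ ξ t, HasDerivAt (h ξ) (h' ξ t) t) (p : 𝔼 × ℝ) :
    HasFDerivAt (waveSuperposition h)
      (∑ k, (spaceCoord k).smulRight (waveSuperposition (fun ξ t => derivSymbol k ξ * h ξ t) p) +
        timeCoord.smulRight (waveSuperposition h' p)) p := by
  have hi := hh.integrable
  have hi' := hh'.integrable
  have hik := fun k => (hk k).integrable
  -- `c.smulRight z` is continuous and linear in `z`, hence commutes with the integral over `ξ`.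
  obtain ⟨L, hL⟩ : ∃ L : (𝔼 × ℝ →L[ℝ] ℝ) → ℂ →L[ℝ] (𝔼 × ℝ →L[ℝ] ℂ),
      ∀ c z, L c z = c.smulRight z :=
    ⟨fun c => ContinuousLinearMap.smulRightL ℝ (𝔼 × ℝ) ℂ c, fun c z => rfl⟩
  simp only [← hL]
  obtain ⟨hm', M', hM', hb'⟩ := hh'
  choose hmk Mk hMk hbk using hk
  have hint : ∀ q : 𝔼 × ℝ, Integrable fun ξ =>
      ∑ k, L (spaceCoord k) (planeWave ξ q.1 * (derivSymbol k ξ * h ξ q.2)) +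
        L timeCoord (planeWave ξ q.1 * h' ξ q.2) := fun q =>
    (integrable_finsetSum _ fun k _ => (L (spaceCoord k)).integrable_comp (hik k q)).add
      ((L timeCoord).integrable_comp (hi' q))
  have key := hasFDerivAt_integral_of_dominated_of_fderiv_le (𝕜 := ℝ) (μ := volume)
    (F := fun (q : 𝔼 × ℝ) ξ => planeWave ξ q.1 * h ξ q.2) (x₀ := p)
    (F' := fun q ξ => ∑ k, L (spaceCoord k) (planeWave ξ q.1 * (derivSymbol k ξ * h ξ q.2)) +
        L timeCoord (planeWave ξ q.1 * h' ξ q.2))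
    (s := {q : 𝔼 × ℝ | |q.2| < |p.2| + 1})
    (bound := fun ξ => ∑ k, ‖L (spaceCoord k)‖ * ((2 + |p.2|) * Mk k ξ) +
      ‖L timeCoord‖ * ((2 + |p.2|) * M' ξ))
    ((isOpen_lt (by fun_prop) continuous_const).mem_nhds (by simp))
    (Eventually.of_forall fun q => (hi q).aestronglyMeasurable) (hi p)
    (hint p).aestronglyMeasurable (Eventually.of_forall fun ξ q hq => ?_)
    ((integrable_finsetSum _ fun k _ => ((hMk k).const_mul _).const_mul _).add
      ((hM'.const_mul _).const_mul _))
    (Eventually.of_forall fun ξ q _ => ?_)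
  · refine key.congr_fderiv ?_
    rw [integral_add (integrable_finsetSum _ fun k _ => (L (spaceCoord k)).integrable_comp (hik k p))
      ((L timeCoord).integrable_comp (hi' p)),
      integral_finsetSum _ fun k _ => (L (spaceCoord k)).integrable_comp (hik k p),
      (L timeCoord).integral_comp_comm (hi' p)]
    congr 1
    exact Finset.sum_congr rfl fun k _ => (L (spaceCoord k)).integral_comp_comm (hik k p)
  · have hq' : 1 + |q.2| ≤ 2 + |p.2| := by
      have : |q.2| < |p.2| + 1 := hq
      linarith
    have aux : ∀ (c : 𝔼 × ℝ →L[ℝ] ℝ) (z : ℂ) (m : ℝ), ‖z‖ ≤ (1 + |q.2|) * m →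
        ‖L c (planeWave ξ q.1 * z)‖ ≤ ‖L c‖ * ((2 + |p.2|) * m) := by
      intro c z m hz
      have hm0 : 0 ≤ m := nonneg_of_mul_nonneg_right ((norm_nonneg _).trans hz) (by positivity)
      refine ((L c).le_opNorm _).trans (mul_le_mul_of_nonneg_left ?_ (norm_nonneg _))
      rw [norm_mul, norm_planeWave, one_mul]
      exact hz.trans (mul_le_mul_of_nonneg_right hq' hm0)
    refine (norm_add_le _ _).trans (add_le_add ((norm_sum_le _ _).trans
      (Finset.sum_le_sum fun k _ => aux _ _ _ (hbk k ξ q.2))) (aux _ _ _ (hb' ξ q.2)))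
  · simp only [hL]
    exact hasFDerivAt_planeWave_mul ξ q (hd ξ q.2)

theorem contDiff_one_waveSuperposition {h h' : 𝔼 → ℝ → ℂ} (hh : DominatedFamily h)
    (hh' : DominatedFamily h') (hk : ∀ k, DominatedFamily fun ξ t => derivSymbol k ξ * h ξ t)
    (hd : ∀ ξ t, HasDerivAt (h ξ) (h' ξ t) t) (hc' : ∀ ξ, Continuous (h' ξ)) :
    ContDiff ℝ 1 (waveSuperposition h) := by
  have hD := hasFDerivAt_waveSuperposition hh hh' hk hd
  rw [contDiff_one_iff_fderiv]
  refine ⟨fun p => (hD p).differentiableAt, ?_⟩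
  rw [funext fun p => (hD p).fderiv]
  have hc : ∀ ξ, Continuous (h ξ) := fun ξ =>
    continuous_iff_continuousAt.2 fun t => (hd ξ t).continuousAt
  refine (continuous_finsetSum _ fun k _ => ?_).add ?_
  · exact (ContinuousLinearMap.smulRightL ℝ (𝔼 × ℝ) ℂ (spaceCoord k)).continuous.comp
      ((hk k).continuous fun ξ => (hc ξ).const_mul _)
  · exact (ContinuousLinearMap.smulRightL ℝ (𝔼 × ℝ) ℂ timeCoord).continuous.comp
      (hh'.continuous hc')

/-- The coefficients of the first derivative are themselves superpositions, to which the `C¹` result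
applies. -/
theorem contDiff_two_waveSuperposition {h h' h'' : 𝔼 → ℝ → ℂ} (hh : DominatedFamily h)
    (hh' : DominatedFamily h') (hh'' : DominatedFamily h'')
    (hk : ∀ k, DominatedFamily fun ξ t => derivSymbol k ξ * h ξ t)
    (hk' : ∀ k, DominatedFamily fun ξ t => derivSymbol k ξ * h' ξ t)
    (hkl : ∀ k l, DominatedFamily fun ξ t => derivSymbol l ξ * (derivSymbol k ξ * h ξ t))
    (hd : ∀ ξ t, HasDerivAt (h ξ) (h' ξ t) t) (hd' : ∀ ξ t, HasDerivAt (h' ξ) (h'' ξ t) t)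
    (hc'' : ∀ ξ, Continuous (h'' ξ)) :
    ContDiff ℝ 2 (waveSuperposition h) := by
  have hD := hasFDerivAt_waveSuperposition hh hh' hk hd
  have hc' : ∀ ξ, Continuous (h' ξ) := fun ξ =>
    continuous_iff_continuousAt.2 fun t => (hd' ξ t).continuousAt
  rw [show (2 : WithTop ℕ∞) = 1 + 1 from rfl, contDiff_succ_iff_fderiv]
  refine ⟨fun p => (hD p).differentiableAt, fun h => by simp at h, ?_⟩
  rw [funext fun p => (hD p).fderiv]
  refine (ContDiff.sum fun k _ => ?_).add ?_
  · exact (ContinuousLinearMap.smulRightL ℝ (𝔼 × ℝ) ℂ (spaceCoord k)).contDiff.comp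
      (contDiff_one_waveSuperposition (hk k) (hk' k) (hkl k)
        (fun ξ t => (hd ξ t).const_mul _) fun ξ => (hc' ξ).const_mul _)
  · exact (ContinuousLinearMap.smulRightL ℝ (𝔼 × ℝ) ℂ timeCoord).contDiff.comp
      (contDiff_one_waveSuperposition hh' hh'' hk' hd' hc'')

/-! ### The explicit solution on the Fourier side -/

/-- The function `t ↦ sin (r t) / r`, with value `t` for `r = 0`. -/
noncomputable def sinQuot (r t : ℝ) : ℝ := if r = 0 then t else Real.sin (r * t) / r

theorem sinQuot_zero (r : ℝ) : sinQuot r 0 = 0 := by simp [sinQuot]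

theorem hasDerivAt_sinQuot (r t : ℝ) : HasDerivAt (sinQuot r) (Real.cos (r * t)) t := by
  unfold sinQuot
  rcases eq_or_ne r 0 with rfl | hr
  · simpa using hasDerivAt_id' t
  · simp only [hr, if_false]
    have := (((hasDerivAt_id t).const_mul r).sin).div_const r
    simpa [hr] using this

theorem mul_sinQuot (r t : ℝ) : r * sinQuot r t = Real.sin (r * t) := by
  unfold sinQuot
  split_ifs with h
  · simp [h]
  · field_simp

theorem abs_sinQuot_le (r t : ℝ) : |sinQuot r t| ≤ |t| := by
  unfold sinQuot
  split_ifs with h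
  · rfl
  · rw [abs_div, div_le_iff₀ (abs_pos.2 h)]
    calc |Real.sin (r * t)| ≤ |r * t| := Real.abs_sin_le_abs
      _ = |t| * |r| := by rw [abs_mul, mul_comm]

theorem measurable_sinQuot (t : ℝ) : Measurable fun r => sinQuot r t := by
  unfold sinQuot
  exact Measurable.ite (measurableSet_singleton 0) measurable_const (by fun_prop)

/-- `|sin (rt) / r| ≤ |t|` handles low frequencies and `|sin| ≤ 1` high ones. The gain of one power
of the frequency is why `u₁` needs one derivative less than `u₀`. -/
theorem one_add_mul_abs_sinQuot_le {ρ : ℝ} (hρ : 0 ≤ ρ) (t : ℝ) :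
    (1 + ρ) * |sinQuot (2 * Real.pi * ρ) t| ≤ 1 + |t| := by
  have h1 := abs_sinQuot_le (2 * Real.pi * ρ) t
  have h2 : (2 * Real.pi * ρ) * |sinQuot (2 * Real.pi * ρ) t| ≤ 1 := by
    have := Real.abs_sin_le_one (2 * Real.pi * ρ * t)
    rwa [← mul_sinQuot, abs_mul, abs_of_nonneg (by positivity)] at this
  have h3 : ρ * |sinQuot (2 * Real.pi * ρ) t| ≤
      (2 * Real.pi * ρ) * |sinQuot (2 * Real.pi * ρ) t| := by
    refine mul_le_mul_of_nonneg_right ?_ (abs_nonneg _)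
    nlinarith [Real.pi_gt_three]
  linarith

/-- The Fourier transform in space of the solution of the wave equation whose Cauchy data have
Fourier transforms `a` and `b`. -/
noncomputable def waveAmplitude (a b : EuclideanSpace ℝ (Fin n) → ℂ)
    (ξ : EuclideanSpace ℝ (Fin n)) (t : ℝ) : ℂ :=
  (Real.cos (2 * Real.pi * ‖ξ‖ * t) : ℂ) * a ξ + (sinQuot (2 * Real.pi * ‖ξ‖) t : ℂ) * b ξ

/-- The time derivative of `waveAmplitude`. -/
noncomputable def waveAmplitudeDeriv (a b : EuclideanSpace ℝ (Fin n) → ℂ)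
    (ξ : EuclideanSpace ℝ (Fin n)) (t : ℝ) : ℂ :=
  (-(2 * Real.pi * ‖ξ‖ * Real.sin (2 * Real.pi * ‖ξ‖ * t)) : ℝ) * a ξ +
    (Real.cos (2 * Real.pi * ‖ξ‖ * t) : ℂ) * b ξ

theorem hasDerivAt_cos_const_mul (r t : ℝ) :
    HasDerivAt (fun t => Real.cos (r * t)) (-(r * Real.sin (r * t))) t := by
  have := ((hasDerivAt_id t).const_mul r).cos
  simpa [mul_comm] using this

theorem hasDerivAt_waveAmplitude (a b : 𝔼 → ℂ) (ξ : 𝔼) (t : ℝ) :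
    HasDerivAt (waveAmplitude a b ξ) (waveAmplitudeDeriv a b ξ t) t :=
  ((hasDerivAt_cos_const_mul _ t).ofReal_comp.mul_const _).add
    ((hasDerivAt_sinQuot _ t).ofReal_comp.mul_const _)

theorem hasDerivAt_waveAmplitudeDeriv (a b : 𝔼 → ℂ) (ξ : 𝔼) (t : ℝ) :
    HasDerivAt (waveAmplitudeDeriv a b ξ)
      (((-(2 * Real.pi * ‖ξ‖) ^ 2 : ℝ) : ℂ) * waveAmplitude a b ξ t) t := by
  have hs : HasDerivAt (fun t => -(2 * Real.pi * ‖ξ‖ * Real.sin (2 * Real.pi * ‖ξ‖ * t)))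
      (-((2 * Real.pi * ‖ξ‖) * (2 * Real.pi * ‖ξ‖ * Real.cos (2 * Real.pi * ‖ξ‖ * t)))) t := by
    have := (((hasDerivAt_id t).const_mul (2 * Real.pi * ‖ξ‖)).sin.const_mul
      (2 * Real.pi * ‖ξ‖)).fun_neg
    refine this.congr_deriv ?_
    simp only [id]
    ring
  have := (hs.ofReal_comp.mul_const (a ξ)).add
    ((hasDerivAt_cos_const_mul (2 * Real.pi * ‖ξ‖) t).ofReal_comp.mul_const (b ξ))
  refine this.congr_deriv ?_
  rw [← mul_sinQuot, waveAmplitude]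
  push_cast
  ring

theorem norm_derivSymbol_le (k : Fin n) (ξ : 𝔼) : ‖derivSymbol k ξ‖ ≤ 2 * Real.pi * (1 + ‖ξ‖) := by
  have h := PiLp.norm_apply_le ξ k
  rw [Real.norm_eq_abs] at h
  rw [derivSymbol, norm_mul, Complex.norm_I, mul_one, Complex.norm_real, Real.norm_eq_abs,
    abs_mul, abs_of_nonneg (by positivity)]
  exact mul_le_mul_of_nonneg_left (by linarith) (by positivity)

theorem continuous_derivSymbol (k : Fin n) : Continuous (derivSymbol k) := by
  unfold derivSymbol
  fun_prop

theorem sum_derivSymbol_mul_self (ξ : 𝔼) :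
    ∑ k, derivSymbol k ξ * derivSymbol k ξ = ((-(2 * Real.pi * ‖ξ‖) ^ 2 : ℝ) : ℂ) := by
  have h : ∀ k, derivSymbol k ξ * derivSymbol k ξ = ((-(2 * Real.pi) ^ 2 * ξ k ^ 2 : ℝ) : ℂ) := by
    intro k
    unfold derivSymbol
    push_cast
    linear_combination ((2 * Real.pi * ξ k) ^ 2 : ℂ) * Complex.I_sq
  rw [Finset.sum_congr rfl fun k _ => h k, ← Complex.ofReal_sum, ← Finset.mul_sum, mul_pow _ ‖ξ‖,
    EuclideanSpace.norm_sq_eq]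
  simp

/-- The weight that dominates the wave amplitude and its derivatives up to order two. -/
noncomputable def amplitudeWeight (a b : EuclideanSpace ℝ (Fin n) → ℂ)
    (ξ : EuclideanSpace ℝ (Fin n)) : ℝ :=
  (1 + ‖ξ‖) ^ 2 * ‖a ξ‖ + (1 + ‖ξ‖) * ‖b ξ‖

theorem norm_waveAmplitude_le (a b : 𝔼 → ℂ) (ξ : 𝔼) (t : ℝ) :
    (1 + ‖ξ‖) ^ 2 * ‖waveAmplitude a b ξ t‖ ≤ (1 + |t|) * amplitudeWeight a b ξ := by
  have h1 : ‖waveAmplitude a b ξ t‖ ≤ ‖a ξ‖ + |sinQuot (2 * Real.pi * ‖ξ‖) t| * ‖b ξ‖ := by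
    refine (norm_add_le _ _).trans ?_
    rw [norm_mul, norm_mul, Complex.norm_real, Complex.norm_real, Real.norm_eq_abs,
      Real.norm_eq_abs]
    gcongr
    exact mul_le_of_le_one_left (norm_nonneg _) (Real.abs_cos_le_one _)
  have h2 := one_add_mul_abs_sinQuot_le (norm_nonneg ξ) t
  calc (1 + ‖ξ‖) ^ 2 * ‖waveAmplitude a b ξ t‖
      ≤ (1 + ‖ξ‖) ^ 2 * (‖a ξ‖ + |sinQuot (2 * Real.pi * ‖ξ‖) t| * ‖b ξ‖) := by gcongr
    _ = 1 * ((1 + ‖ξ‖) ^ 2 * ‖a ξ‖) +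
        ((1 + ‖ξ‖) * |sinQuot (2 * Real.pi * ‖ξ‖) t|) * ((1 + ‖ξ‖) * ‖b ξ‖) := by ring
    _ ≤ (1 + |t|) * ((1 + ‖ξ‖) ^ 2 * ‖a ξ‖) + (1 + |t|) * ((1 + ‖ξ‖) * ‖b ξ‖) := by
        gcongr
        linarith [abs_nonneg t]
    _ = (1 + |t|) * amplitudeWeight a b ξ := by unfold amplitudeWeight; ring

theorem norm_waveAmplitudeDeriv_le (a b : 𝔼 → ℂ) (ξ : 𝔼) (t : ℝ) :
    (1 + ‖ξ‖) * ‖waveAmplitudeDeriv a b ξ t‖ ≤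
      2 * Real.pi * ((1 + |t|) * amplitudeWeight a b ξ) := by
  have hpi := Real.pi_gt_three
  have h1 : ‖waveAmplitudeDeriv a b ξ t‖ ≤ 2 * Real.pi * (1 + ‖ξ‖) * ‖a ξ‖ + 1 * ‖b ξ‖ := by
    refine (norm_add_le _ _).trans ?_
    rw [norm_mul, norm_mul, Complex.norm_real, Complex.norm_real, Real.norm_eq_abs,
      Real.norm_eq_abs, abs_neg, abs_mul, abs_of_nonneg (by positivity : 0 ≤ 2 * Real.pi * ‖ξ‖)]
    have hs := Real.abs_sin_le_one (2 * Real.pi * ‖ξ‖ * t)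
    refine add_le_add (mul_le_mul_of_nonneg_right ?_ (norm_nonneg _))
      (mul_le_mul_of_nonneg_right ?_ (norm_nonneg _))
    · calc 2 * Real.pi * ‖ξ‖ * |Real.sin (2 * Real.pi * ‖ξ‖ * t)|
          ≤ 2 * Real.pi * ‖ξ‖ * 1 := by gcongr
        _ ≤ 2 * Real.pi * (1 + ‖ξ‖) := by linarith
    · exact Real.abs_cos_le_one _
  calc (1 + ‖ξ‖) * ‖waveAmplitudeDeriv a b ξ t‖
      ≤ (1 + ‖ξ‖) * (2 * Real.pi * (1 + ‖ξ‖) * ‖a ξ‖ + 1 * ‖b ξ‖) := by gcongr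
    _ = 2 * Real.pi * ((1 + ‖ξ‖) ^ 2 * ‖a ξ‖) + 1 * ((1 + ‖ξ‖) * ‖b ξ‖) := by ring
    _ ≤ 2 * Real.pi * ((1 + ‖ξ‖) ^ 2 * ‖a ξ‖) + 2 * Real.pi * ((1 + ‖ξ‖) * ‖b ξ‖) := by
        gcongr
        linarith
    _ = 2 * Real.pi * (1 * amplitudeWeight a b ξ) := by unfold amplitudeWeight; ring
    _ ≤ 2 * Real.pi * ((1 + |t|) * amplitudeWeight a b ξ) := by
        have : 0 ≤ amplitudeWeight a b ξ := by unfold amplitudeWeight; positivity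
        gcongr
        linarith [abs_nonneg t]

theorem aestronglyMeasurable_waveAmplitude {a b : 𝔼 → ℂ} (ha : AEStronglyMeasurable a volume)
    (hb : AEStronglyMeasurable b volume) (t : ℝ) :
    AEStronglyMeasurable (fun ξ => waveAmplitude a b ξ t) volume := by
  have h1 : Measurable fun ξ : 𝔼 => (sinQuot (2 * Real.pi * ‖ξ‖) t : ℂ) :=
    Complex.measurable_ofReal.comp ((measurable_sinQuot t).comp (by fun_prop))
  have h2 : Measurable fun ξ : 𝔼 => (Real.cos (2 * Real.pi * ‖ξ‖ * t) : ℂ) := by fun_prop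
  exact (h2.aestronglyMeasurable.mul ha).add (h1.aestronglyMeasurable.mul hb)

theorem aestronglyMeasurable_waveAmplitudeDeriv {a b : 𝔼 → ℂ}
    (ha : AEStronglyMeasurable a volume) (hb : AEStronglyMeasurable b volume) (t : ℝ) :
    AEStronglyMeasurable (fun ξ => waveAmplitudeDeriv a b ξ t) volume := by
  have h1 : Measurable fun ξ : 𝔼 =>
      ((-(2 * Real.pi * ‖ξ‖ * Real.sin (2 * Real.pi * ‖ξ‖ * t)) : ℝ) : ℂ) := by fun_prop
  have h2 : Measurable fun ξ : 𝔼 => (Real.cos (2 * Real.pi * ‖ξ‖ * t) : ℂ) := by fun_prop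
  exact (h1.aestronglyMeasurable.mul ha).add (h2.aestronglyMeasurable.mul hb)

theorem dominatedFamily_of_le {f : 𝔼 → ℝ → ℂ} {M : 𝔼 → ℝ}
    (hf : ∀ t, AEStronglyMeasurable (fun ξ => f ξ t) volume) (hM : Integrable M) (C : ℝ)
    (hb : ∀ ξ t, ‖f ξ t‖ ≤ C * ((1 + |t|) * M ξ)) : DominatedFamily f :=
  ⟨hf, fun ξ => C * M ξ, hM.const_mul C, fun ξ t => (hb ξ t).trans_eq (by ring)⟩

/-- Classical solutions of the wave equation from sufficiently integrable Fourier transforms of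
the Cauchy data. -/
theorem exists_wave_solution_of_fourier {a b : 𝔼 → ℂ} (ha : AEStronglyMeasurable a volume)
    (hb : AEStronglyMeasurable b volume) (ha2 : Integrable fun ξ => (1 + ‖ξ‖) ^ 2 * ‖a ξ‖)
    (hb1 : Integrable fun ξ => (1 + ‖ξ‖) * ‖b ξ‖) :
    ∃ u : 𝔼 × ℝ → ℝ, ContDiff ℝ 2 u ∧ (∀ p, waveOperator u p = 0) ∧
      (∀ x, u (x, 0) = (∫ ξ, planeWave ξ x * a ξ).re) ∧
      ∀ x, deriv (fun t => u (x, t)) 0 = (∫ ξ, planeWave ξ x * b ξ).re := by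
  set h := waveAmplitude a b
  set h' := waveAmplitudeDeriv a b
  set h'' : 𝔼 → ℝ → ℂ := fun ξ t => ((-(2 * Real.pi * ‖ξ‖) ^ 2 : ℝ) : ℂ) * h ξ t
  have hM : Integrable (amplitudeWeight a b) := ha2.add hb1
  have hm := aestronglyMeasurable_waveAmplitude ha hb
  have hm' := aestronglyMeasurable_waveAmplitudeDeriv ha hb
  have hd := hasDerivAt_waveAmplitude a b
  have hd' := hasDerivAt_waveAmplitudeDeriv a b
  have hle := norm_waveAmplitude_le a b
  have hle' := norm_waveAmplitudeDeriv_le a b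
  have hs : ∀ k : Fin n, AEStronglyMeasurable (derivSymbol k) volume := fun k =>
    (continuous_derivSymbol k).aestronglyMeasurable
  have pi0 := Real.pi_pos
  have hkl : ∀ k l, DominatedFamily fun ξ t => derivSymbol l ξ * (derivSymbol k ξ * h ξ t) := by
    intro k l
    refine dominatedFamily_of_le (fun t => (hs l).mul ((hs k).mul (hm t))) hM ((2 * Real.pi) ^ 2)
      fun ξ t => ?_
    rw [norm_mul, norm_mul]
    calc _ ≤ (2 * Real.pi * (1 + ‖ξ‖)) * ((2 * Real.pi * (1 + ‖ξ‖)) * ‖h ξ t‖) := by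
            gcongr <;> exact norm_derivSymbol_le _ _
      _ = (2 * Real.pi) ^ 2 * ((1 + ‖ξ‖) ^ 2 * ‖h ξ t‖) := by ring
      _ ≤ _ := by exact mul_le_mul_of_nonneg_left (hle ξ t) (by positivity)
  have hk : ∀ k, DominatedFamily fun ξ t => derivSymbol k ξ * h ξ t := by
    intro k
    refine dominatedFamily_of_le (fun t => (hs k).mul (hm t)) hM (2 * Real.pi) fun ξ t => ?_
    rw [norm_mul]
    calc _ ≤ (2 * Real.pi * (1 + ‖ξ‖)) * ‖h ξ t‖ := by
            gcongr; exact norm_derivSymbol_le _ _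
      _ = (2 * Real.pi) * ((1 + ‖ξ‖) ^ 1 * ‖h ξ t‖) := by ring
      _ ≤ (2 * Real.pi) * ((1 + ‖ξ‖) ^ 2 * ‖h ξ t‖) := by
            gcongr
            · linarith [norm_nonneg ξ]
            · norm_num
      _ ≤ _ := by exact mul_le_mul_of_nonneg_left (hle ξ t) (by positivity)
  have hk' : ∀ k, DominatedFamily fun ξ t => derivSymbol k ξ * h' ξ t := by
    intro k
    refine dominatedFamily_of_le (fun t => (hs k).mul (hm' t)) hM (2 * Real.pi * (2 * Real.pi))
      fun ξ t => ?_
    rw [norm_mul]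
    calc _ ≤ (2 * Real.pi * (1 + ‖ξ‖)) * ‖h' ξ t‖ := by
            gcongr; exact norm_derivSymbol_le _ _
      _ = (2 * Real.pi) * ((1 + ‖ξ‖) * ‖h' ξ t‖) := by ring
      _ ≤ (2 * Real.pi) * (2 * Real.pi * ((1 + |t|) * amplitudeWeight a b ξ)) := by
          exact mul_le_mul_of_nonneg_left (hle' ξ t) (by positivity)
      _ = _ := by ring
  have hh : DominatedFamily h := by
    refine dominatedFamily_of_le hm hM 1 fun ξ t => ?_
    rw [one_mul]
    refine le_trans ?_ (hle ξ t)
    exact le_mul_of_one_le_left (norm_nonneg _) (one_le_pow₀ (by linarith [norm_nonneg ξ]))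
  have hh' : DominatedFamily h' := by
    refine dominatedFamily_of_le hm' hM (2 * Real.pi) fun ξ t => ?_
    refine le_trans ?_ (hle' ξ t)
    exact le_mul_of_one_le_left (norm_nonneg _) (by linarith [norm_nonneg ξ])
  -- This is the wave equation at a single frequency.
  have hsum : ∀ ξ t, h'' ξ t = ∑ k, derivSymbol k ξ * (derivSymbol k ξ * h ξ t) := by
    intro ξ t
    simp only [h'', ← sum_derivSymbol_mul_self, Finset.sum_mul]
    exact Finset.sum_congr rfl fun k _ => mul_assoc _ _ _
  have hh'' : DominatedFamily h'' := by
    refine dominatedFamily_of_le (fun t => ?_) hM ((2 * Real.pi) ^ 2) fun ξ t => ?_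
    · have : Measurable fun ξ : 𝔼 => ((-(2 * Real.pi * ‖ξ‖) ^ 2 : ℝ) : ℂ) := by fun_prop
      exact this.aestronglyMeasurable.mul (hm t)
    · simp only [h'']
      rw [norm_mul, Complex.norm_real, norm_neg, norm_pow, Real.norm_eq_abs, sq_abs]
      calc _ = (2 * Real.pi) ^ 2 * (‖ξ‖ ^ 2 * ‖h ξ t‖) := by
            ring
        _ ≤ (2 * Real.pi) ^ 2 * ((1 + ‖ξ‖) ^ 2 * ‖h ξ t‖) := by gcongr; linarith
        _ ≤ _ := by exact mul_le_mul_of_nonneg_left (hle ξ t) (by positivity)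
  have hc : ∀ ξ, Continuous (h ξ) := fun ξ =>
    continuous_iff_continuousAt.2 fun t => (hd ξ t).continuousAt
  have hU : ContDiff ℝ 2 (waveSuperposition h) :=
    contDiff_two_waveSuperposition hh hh' hh'' hk hk' hkl hd hd' fun ξ => (hc ξ).const_mul _
  -- The wave equation has real coefficients, so the real part is again a solution; the
  -- superposition need not be shown to be real.
  have hre : ContDiff ℝ 2 fun p => (waveSuperposition h p).re := Complex.reCLM.contDiff.comp hU
  have hdre : ∀ {f f' : 𝔼 → ℝ → ℂ}, DominatedFamily f → DominatedFamily f' →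
      (∀ k, DominatedFamily fun ξ t => derivSymbol k ξ * f ξ t) →
      (∀ ξ t, HasDerivAt (f ξ) (f' ξ t) t) → ∀ (p : 𝔼 × ℝ) (v : 𝔼 × ℝ),
      fderiv ℝ (fun p => (waveSuperposition f p).re) p v =
        ∑ k, v.1 k * (waveSuperposition (fun ξ t => derivSymbol k ξ * f ξ t) p).re +
          v.2 * (waveSuperposition f' p).re := by
    intro f f' h1 h2 h3 h4 p v
    have := (Complex.reCLM.hasFDerivAt).comp p (hasFDerivAt_waveSuperposition h1 h2 h3 h4 p)
    rw [HasFDerivAt.fderiv (f := fun p => (waveSuperposition f p).re) this]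
    simp [spaceCoord, timeCoord]
  have hspace : ∀ k : Fin n, (fun q => fderiv ℝ (fun p => (waveSuperposition h p).re) q
      (EuclideanSpace.single k 1, 0)) =
      fun q => (waveSuperposition (fun ξ t => derivSymbol k ξ * h ξ t) q).re := by
    intro k
    ext q
    rw [hdre hh hh' hk hd]
    simp
  have htime : (fun q => fderiv ℝ (fun p => (waveSuperposition h p).re) q (0, 1)) =
      fun q => (waveSuperposition h' q).re := by
    ext q
    rw [hdre hh hh' hk hd]
    simp
  refine ⟨fun p => (waveSuperposition h p).re, hre, fun p => ?_, fun x => ?_, fun x => ?_⟩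
  · rw [waveOperator_eq_fderiv hre, htime, hdre hh' hh'' hk' hd', sub_eq_zero]
    simp only [hspace]
    have : ∀ k : Fin n, fderiv ℝ
        (fun q => (waveSuperposition (fun ξ t => derivSymbol k ξ * h ξ t) q).re) p
        (EuclideanSpace.single k 1, 0) =
        (waveSuperposition (fun ξ t => derivSymbol k ξ * (derivSymbol k ξ * h ξ t)) p).re := by
      intro k
      rw [hdre (hk k) (hk' k) (hkl k) fun ξ t => (hd ξ t).const_mul _]
      simp
    rw [Finset.sum_congr rfl fun k _ => this k, ← Complex.re_sum]
    have e : waveSuperposition h'' p = ∑ k,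
        waveSuperposition (fun ξ t => derivSymbol k ξ * (derivSymbol k ξ * h ξ t)) p := by
      unfold waveSuperposition
      rw [← integral_finsetSum _ fun k _ => (hkl k k).integrable p]
      simp only [hsum, Finset.mul_sum]
    rw [e]
    simp
  · simp [waveSuperposition, h, waveAmplitude, sinQuot_zero]
  · have := (hasDerivAt_slice_snd (hre.differentiable two_ne_zero (x, 0))).deriv
    rw [this, congrFun htime (x, 0)]
    simp [waveSuperposition, h', waveAmplitudeDeriv]

/-! ### Weak derivatives and localization -/

/-- `g` is the weak partial derivative `∂_j f`. -/
def IsWeakPartial (j : Fin n) (f g : EuclideanSpace ℝ (Fin n) → ℝ) : Prop :=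
  ∀ φ : EuclideanSpace ℝ (Fin n) → ℝ, ContDiff ℝ ∞ φ → HasCompactSupport φ →
    ∫ x, f x * fderiv ℝ φ x (EuclideanSpace.single j 1) = -∫ x, g x * φ x

/-- The local Sobolev class of order `k` (for exponent two), defined by iterating first order weak
derivatives. -/
def LocalSobolev : ℕ → (EuclideanSpace ℝ (Fin n) → ℝ) → Prop
  | 0, f => SquareIntegrableOnBounded f
  | k + 1, f => SquareIntegrableOnBounded f ∧ ∀ j, ∃ g, LocalSobolev k g ∧ IsWeakPartial j f g

/-- The compactly supported members of the Sobolev class of order `k` (for exponent two). -/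
def CompactSobolev : ℕ → (EuclideanSpace ℝ (Fin n) → ℝ) → Prop
  | 0, f => HasCompactSupport f ∧ MemLp f 2 volume
  | k + 1, f => (HasCompactSupport f ∧ MemLp f 2 volume) ∧
      ∀ j, ∃ g, CompactSobolev k g ∧ IsWeakPartial j f g

theorem exists_smooth_cutoff (R : ℝ) : ∃ ψ : 𝔼 → ℝ, ContDiff ℝ ∞ ψ ∧ HasCompactSupport ψ ∧
    ∀ x, ‖x‖ < R → ψ x = 1 := by
  let ψ : ContDiffBump (0 : 𝔼) := ⟨max R 1, max R 1 + 1, by positivity, by linarith⟩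
  refine ⟨ψ, ψ.contDiff, ψ.hasCompactSupport, fun x hx => ψ.one_of_mem_closedBall ?_⟩
  rw [mem_closedBall_zero_iff]
  exact hx.le.trans (le_max_left _ _)

theorem ContDiff.fderiv_apply_const_infty {φ : 𝔼 → ℝ} (hφ : ContDiff ℝ ∞ φ) (v : 𝔼) :
    ContDiff ℝ ∞ fun x => fderiv ℝ φ x v :=
  (hφ.fderiv_right (m := ∞) (by simp)).clm_apply contDiff_const

theorem HasCompactSupport.fderiv_apply_const {φ : 𝔼 → ℝ} (hφ : HasCompactSupport φ) (v : 𝔼) :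
    HasCompactSupport fun x => fderiv ℝ φ x v :=
  (hφ.fderiv (𝕜 := ℝ)).comp_left (g := fun L : 𝔼 →L[ℝ] ℝ => L v) rfl

theorem partialDerivative_cons {k : ℕ} {φ : 𝔼 → ℝ} (hφ : ContDiff ℝ ∞ φ) (j : Fin n)
    (i : Fin k → Fin n) (x : 𝔼) :
    partialDerivative (Fin.cons j i : Fin (k + 1) → Fin n) φ x =
      fderiv ℝ (partialDerivative i φ) x (EuclideanSpace.single j 1) := by
  unfold partialDerivative
  rw [iteratedFDeriv_succ_apply_left]
  have hd : DifferentiableAt ℝ (iteratedFDeriv ℝ k φ) x :=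
    (hφ.differentiable_iteratedFDeriv (by exact_mod_cast WithTop.coe_lt_top _)) x
  have := ((ContinuousMultilinearMap.apply ℝ (fun _ : Fin k => 𝔼) ℝ
    (fun l => EuclideanSpace.single (i l) (1 : ℝ))).hasFDerivAt.comp x hd.hasFDerivAt).fderiv
  simp only [Function.comp_def, ContinuousMultilinearMap.apply_apply] at this
  rw [this]
  rfl

theorem contDiff_partialDerivative {k : ℕ} {φ : 𝔼 → ℝ} (hφ : ContDiff ℝ ∞ φ)
    (i : Fin k → Fin n) : ContDiff ℝ ∞ (partialDerivative i φ) := by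
  refine (ContinuousMultilinearMap.apply ℝ (fun _ : Fin k => 𝔼) ℝ
    (fun l => EuclideanSpace.single (i l) (1 : ℝ))).contDiff.comp
    (hφ.iteratedFDeriv_right (m := ∞) ?_)
  exact_mod_cast le_rfl

theorem hasCompactSupport_partialDerivative {k : ℕ} {φ : 𝔼 → ℝ} (hφ : HasCompactSupport φ)
    (i : Fin k → Fin n) : HasCompactSupport (partialDerivative i φ) :=
  (hφ.iteratedFDeriv (𝕜 := ℝ) k).comp_left
    (g := fun L : ContinuousMultilinearMap ℝ (fun _ : Fin k => 𝔼) ℝ =>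
      L (fun l => EuclideanSpace.single (i l) (1 : ℝ))) rfl

/-- Testing `∂_j f = g` with `∂_i φ` shows that the derivative of `f` with index `Fin.cons j i` is
the derivative of `g` with index `i`. Derivatives are moved only on test functions. -/
theorem localSobolev_of_generalizedDerivatives (K : ℕ) : ∀ f : 𝔼 → ℝ,
    SquareIntegrableOnBounded f →
    (∀ k ≤ K, ∀ i : Fin k → Fin n, ∃ g, SquareIntegrableOnBounded g ∧
      IsGeneralizedDerivative i f g) → LocalSobolev K f := by
  induction K with
  | zero => exact fun f hf _ => hf
  | succ K ih =>
    intro f hf h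
    refine ⟨hf, fun j => ?_⟩
    obtain ⟨g, hg, hfg⟩ := h 1 (by omega) (Fin.cons j Fin.elim0)
    have hw : IsWeakPartial j f g := by
      intro φ hφ hc
      have := hfg φ hφ hc
      simp only [partialDerivative_cons hφ, pow_one, neg_mul, one_mul] at this
      rw [← this]
      rfl
    refine ⟨g, ih g hg fun k hk i => ?_, hw⟩
    obtain ⟨g', hg', hfg'⟩ := h (k + 1) (by omega) (Fin.cons j i)
    refine ⟨g', hg', fun φ hφ hc => ?_⟩
    have h1 := hfg' φ hφ hc
    have h2 := hw _ (contDiff_partialDerivative hφ i) (hasCompactSupport_partialDerivative hc i)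
    simp only [partialDerivative_cons hφ] at h1
    rw [h1, pow_succ] at h2
    linarith

theorem HasSquareIntegrableDerivativesUpTo.localSobolev {s : ℝ} {f : 𝔼 → ℝ}
    (hf : HasSquareIntegrableDerivativesUpTo s f) {K : ℕ} (hK : (K : ℝ) ≤ s) : LocalSobolev K f :=
  localSobolev_of_generalizedDerivatives K f hf.1 fun k hk =>
    hf.2 k ((Nat.cast_le.2 hk).trans hK)

theorem LocalSobolev.squareIntegrable {k : ℕ} {f : 𝔼 → ℝ} (hf : LocalSobolev k f) :
    SquareIntegrableOnBounded f := by
  cases k with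
  | zero => exact hf
  | succ k => exact hf.1

theorem LocalSobolev.of_succ {k : ℕ} : ∀ {f : 𝔼 → ℝ}, LocalSobolev (k + 1) f →
    LocalSobolev k f := by
  induction k with
  | zero => exact fun hf => hf.1
  | succ k ih =>
    intro f hf
    refine ⟨hf.1, fun j => ?_⟩
    obtain ⟨g, hg, hfg⟩ := hf.2 j
    exact ⟨g, ih hg, hfg⟩

theorem CompactSobolev.base {k : ℕ} {f : 𝔼 → ℝ} (hf : CompactSobolev k f) :
    HasCompactSupport f ∧ MemLp f 2 volume := by
  cases k with
  | zero => exact hf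
  | succ k => exact hf.1

theorem CompactSobolev.of_succ {k : ℕ} : ∀ {f : 𝔼 → ℝ}, CompactSobolev (k + 1) f →
    CompactSobolev k f := by
  induction k with
  | zero => exact fun hf => hf.1
  | succ k ih =>
    intro f hf
    refine ⟨hf.1, fun j => ?_⟩
    obtain ⟨g, hg, hfg⟩ := hf.2 j
    exact ⟨g, ih hg, hfg⟩

theorem memLp_mul_of_hasCompactSupport {f ψ : 𝔼 → ℝ} (hf : SquareIntegrableOnBounded f)
    (hψ : Continuous ψ) (hc : HasCompactSupport ψ) : MemLp (fun x => ψ x * f x) 2 volume := by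
  have hS : MeasurableSet (tsupport ψ) := (isClosed_tsupport ψ).measurableSet
  obtain ⟨C, hC⟩ := hψ.bounded_above_of_compact_support hc
  have h1 : MemLp f 2 (volume.restrict (tsupport ψ)) := hf _ hc.isCompact.isBounded
  have h2 : MemLp (fun x => ψ x * f x) 2 (volume.restrict (tsupport ψ)) :=
    h1.of_le_mul (c := C) (hψ.aestronglyMeasurable.mul h1.1) (Eventually.of_forall fun x => by
      rw [norm_mul]; exact mul_le_mul_of_nonneg_right (hC x) (norm_nonneg _))
  have h3 := (memLp_indicator_iff_restrict hS).2 h2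
  refine h3.ae_eq (Eventually.of_forall fun x => ?_)
  by_cases hx : x ∈ tsupport ψ
  · simp [hx]
  · simp [hx, image_eq_zero_of_notMem_tsupport hx]

theorem integrable_of_hasCompactSupport_of_memLp {f : 𝔼 → ℝ} (hc : HasCompactSupport f)
    (hf : MemLp f 2 volume) : Integrable f := by
  have : IsFiniteMeasure (volume.restrict (tsupport f)) :=
    ⟨by simpa using hc.isCompact.measure_lt_top⟩
  have h1 : IntegrableOn f (tsupport f) := (hf.restrict _).integrable (by norm_num)
  exact (integrableOn_iff_integrable_of_support_subset (subset_tsupport f)).1 h1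

theorem integrable_mul_of_hasCompactSupport {f ψ : 𝔼 → ℝ} (hf : SquareIntegrableOnBounded f)
    (hψ : Continuous ψ) (hc : HasCompactSupport ψ) : Integrable fun x => ψ x * f x :=
  integrable_of_hasCompactSupport_of_memLp hc.mul_right (memLp_mul_of_hasCompactSupport hf hψ hc)

theorem SquareIntegrableOnBounded.of_memLp {f : 𝔼 → ℝ} (hf : MemLp f 2 volume) :
    SquareIntegrableOnBounded f := fun B _ => hf.restrict B

theorem IsWeakPartial.add {j : Fin n} {f₁ f₂ g₁ g₂ : 𝔼 → ℝ}
    (hf₁ : SquareIntegrableOnBounded f₁) (hf₂ : SquareIntegrableOnBounded f₂)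
    (hg₁ : SquareIntegrableOnBounded g₁) (hg₂ : SquareIntegrableOnBounded g₂)
    (h₁ : IsWeakPartial j f₁ g₁) (h₂ : IsWeakPartial j f₂ g₂) :
    IsWeakPartial j (fun x => f₁ x + f₂ x) (fun x => g₁ x + g₂ x) := by
  intro φ hφ hc
  have hφ' := (hφ.fderiv_apply_const_infty (EuclideanSpace.single j 1)).continuous
  have hc' := hc.fderiv_apply_const (EuclideanSpace.single j 1)
  have i : ∀ {f ψ : 𝔼 → ℝ}, SquareIntegrableOnBounded f → Continuous ψ → HasCompactSupport ψ →
      Integrable fun x => f x * ψ x := fun {f ψ} a b c => by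
    simpa only [mul_comm] using integrable_mul_of_hasCompactSupport a b c
  simp only [add_mul]
  rw [integral_add (i hf₁ hφ' hc') (i hf₂ hφ' hc'),
    integral_add (i hg₁ hφ.continuous hc) (i hg₂ hφ.continuous hc), h₁ φ hφ hc, h₂ φ hφ hc]
  ring

/-- The Leibniz rule, obtained by testing the weak derivative of `f` with `ψ φ`. -/
theorem IsWeakPartial.mul {j : Fin n} {f g ψ : 𝔼 → ℝ}
    (hfg : IsWeakPartial j f g) (hf : SquareIntegrableOnBounded f)
    (hg : SquareIntegrableOnBounded g) (hψ : ContDiff ℝ ∞ ψ) :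
    IsWeakPartial j (fun x => ψ x * f x)
      (fun x => ψ x * g x + fderiv ℝ ψ x (EuclideanSpace.single j 1) * f x) := by
  intro φ hφ hc
  set e : 𝔼 := EuclideanSpace.single j 1
  have hψφ : HasCompactSupport fun x => ψ x * φ x := hc.mul_left
  have hp : ∀ x, fderiv ℝ (fun x => ψ x * φ x) x e =
      ψ x * fderiv ℝ φ x e + φ x * fderiv ℝ ψ x e := by
    intro x
    rw [fderiv_fun_mul (hψ.differentiable (by simp) x) (hφ.differentiable (by simp) x)]
    simp
  have i1 : Integrable fun x => fderiv ℝ (fun x => ψ x * φ x) x e * f x :=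
    integrable_mul_of_hasCompactSupport hf
    ((hψ.mul hφ).fderiv_apply_const_infty e).continuous (hψφ.fderiv_apply_const e)
  have i2 : Integrable fun x => φ x * fderiv ℝ ψ x e * f x :=
    integrable_mul_of_hasCompactSupport hf
    (hφ.continuous.mul (hψ.fderiv_apply_const_infty e).continuous) hc.mul_right
  have i3 : Integrable fun x => ψ x * φ x * g x :=
    integrable_mul_of_hasCompactSupport hg (hψ.continuous.mul hφ.continuous) hψφ
  have h1 := hfg _ (hψ.mul hφ) hψφ
  calc ∫ x, ψ x * f x * fderiv ℝ φ x e
      = ∫ x, fderiv ℝ (fun x => ψ x * φ x) x e * f x - φ x * fderiv ℝ ψ x e * f x :=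
        integral_congr_ae (Eventually.of_forall fun x => by simp only [hp]; ring)
    _ = (∫ x, fderiv ℝ (fun x => ψ x * φ x) x e * f x) - ∫ x, φ x * fderiv ℝ ψ x e * f x :=
        integral_sub i1 i2
    _ = -((∫ x, ψ x * φ x * g x) + ∫ x, φ x * fderiv ℝ ψ x e * f x) := by
        rw [neg_add, ← sub_eq_add_neg]
        congr 1
        simpa only [mul_comm] using h1
    _ = -∫ x, (ψ x * g x + fderiv ℝ ψ x e * f x) * φ x := by
        rw [← integral_add i3 i2]
        congr 2
        ext x
        ring

theorem CompactSobolev.add {k : ℕ} : ∀ {f₁ f₂ : 𝔼 → ℝ}, CompactSobolev k f₁ →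
    CompactSobolev k f₂ → CompactSobolev k (fun x => f₁ x + f₂ x) := by
  induction k with
  | zero => exact fun h₁ h₂ => ⟨h₁.1.add h₂.1, h₁.2.add h₂.2⟩
  | succ k ih =>
    intro f₁ f₂ h₁ h₂
    refine ⟨⟨h₁.1.1.add h₂.1.1, h₁.1.2.add h₂.1.2⟩, fun j => ?_⟩
    obtain ⟨g₁, hg₁, hw₁⟩ := h₁.2 j
    obtain ⟨g₂, hg₂, hw₂⟩ := h₂.2 j
    exact ⟨_, ih hg₁ hg₂, IsWeakPartial.add (.of_memLp h₁.1.2) (.of_memLp h₂.1.2)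
      (.of_memLp hg₁.base.2) (.of_memLp hg₂.base.2) hw₁ hw₂⟩

/-- By the Leibniz rule a derivative of `ψ f` is a sum of two products of the same shape, one with
cutoff `∂_j ψ`; the induction therefore runs over all cutoffs at once. -/
theorem LocalSobolev.mul_cutoff {k : ℕ} : ∀ {f ψ : 𝔼 → ℝ}, LocalSobolev k f →
    ContDiff ℝ ∞ ψ → HasCompactSupport ψ → CompactSobolev k (fun x => ψ x * f x) := by
  induction k with
  | zero =>
    exact fun hf hψ hc => ⟨hc.mul_right, memLp_mul_of_hasCompactSupport hf hψ.continuous hc⟩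
  | succ k ih =>
    intro f ψ hf hψ hc
    refine ⟨⟨hc.mul_right, memLp_mul_of_hasCompactSupport hf.1 hψ.continuous hc⟩, fun j => ?_⟩
    obtain ⟨g, hg, hfg⟩ := hf.2 j
    exact ⟨_, (ih hg hψ hc).add (ih hf.of_succ (hψ.fderiv_apply_const_infty _)
      (hc.fderiv_apply_const _)), hfg.mul hf.1 hg.squareIntegrable hψ⟩

/-! ### Fourier transforms of compactly supported Sobolev functions -/

open FourierTransform in
/-- The Fourier transform of a real valued function. -/
noncomputable def realFourier (f : EuclideanSpace ℝ (Fin n) → ℝ) :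
    EuclideanSpace ℝ (Fin n) → ℂ :=
  𝓕 (fun x => (f x : ℂ))

/-- Weak derivatives are tested with real functions only, so the exponential is split into cosine
and sine. -/
theorem realFourier_eq {f : 𝔼 → ℝ} (hf : Integrable f) (ξ : 𝔼) :
    realFourier f ξ = ((∫ x, f x * Real.cos (2 * Real.pi * inner ℝ x ξ) : ℝ) : ℂ) -
      ((∫ x, f x * Real.sin (2 * Real.pi * inner ℝ x ξ) : ℝ) : ℂ) * Complex.I := by
  have hcos : Integrable fun x => f x * Real.cos (2 * Real.pi * inner ℝ x ξ) :=
    hf.mul_bdd (c := 1) (by fun_prop) (Eventually.of_forall fun x => Real.abs_cos_le_one _)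
  have hsin : Integrable fun x => f x * Real.sin (2 * Real.pi * inner ℝ x ξ) :=
    hf.mul_bdd (c := 1) (by fun_prop) (Eventually.of_forall fun x => Real.abs_sin_le_one _)
  rw [← integral_complex_ofReal, ← integral_complex_ofReal, ← integral_mul_const,
    ← integral_sub hcos.ofReal (hsin.ofReal.mul_const _)]
  rw [realFourier, Real.fourier_eq']
  congr 1
  ext x
  rw [Complex.exp_mul_I, smul_eq_mul, ← Complex.ofReal_cos, ← Complex.ofReal_sin,
    show -2 * Real.pi * inner ℝ x ξ = -(2 * Real.pi * inner ℝ x ξ) by ring, Real.cos_neg,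
    Real.sin_neg]
  push_cast
  ring

/-- Multiplying `φ` by a cutoff equal to 1 near both supports changes neither integral, so
trigonometric test functions become admissible. -/
theorem IsWeakPartial.integral_eq {j : Fin n} {f g φ : 𝔼 → ℝ} (hfg : IsWeakPartial j f g)
    (hf : HasCompactSupport f) (hg : HasCompactSupport g) (hφ : ContDiff ℝ ∞ φ) :
    ∫ x, f x * fderiv ℝ φ x (EuclideanSpace.single j 1) = -∫ x, g x * φ x := by
  obtain ⟨R₁, hR₁⟩ := hf.isCompact.isBounded.subset_ball 0
  obtain ⟨R₂, hR₂⟩ := hg.isCompact.isBounded.subset_ball 0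
  obtain ⟨ψ, hψ, hψc, hψ1⟩ := exists_smooth_cutoff (n := n) (max R₁ R₂)
  have h := hfg (fun x => ψ x * φ x) (hψ.mul hφ) hψc.mul_right
  convert h using 2
  · ext x
    by_cases hx : x ∈ tsupport f
    · have hxR : ‖x‖ < max R₁ R₂ :=
        (mem_ball_zero_iff.1 (hR₁ hx)).trans_le (le_max_left _ _)
      have : (fun x => ψ x * φ x) =ᶠ[𝓝 x] φ := by
        filter_upwards [(isOpen_lt continuous_norm continuous_const).mem_nhds hxR] with y hy
        rw [hψ1 y hy, one_mul]
      rw [this.fderiv_eq]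
    · simp [image_eq_zero_of_notMem_tsupport hx]
  · congr 1
    ext x
    by_cases hx : x ∈ tsupport g
    · rw [hψ1 x ((mem_ball_zero_iff.1 (hR₂ hx)).trans_le (le_max_right _ _)), one_mul]
    · simp [image_eq_zero_of_notMem_tsupport hx]

theorem IsWeakPartial.realFourier_eq {j : Fin n} {f g : 𝔼 → ℝ} (hfg : IsWeakPartial j f g)
    (hf : HasCompactSupport f) (hf2 : MemLp f 2 volume)
    (hg : HasCompactSupport g) (hg2 : MemLp g 2 volume) (ξ : 𝔼) :
    realFourier g ξ = derivSymbol j ξ * realFourier f ξ := by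
  rw [_root_.realFourier_eq (integrable_of_hasCompactSupport_of_memLp hf hf2),
    _root_.realFourier_eq (integrable_of_hasCompactSupport_of_memLp hg hg2)]
  have hin : ∀ x : 𝔼, HasFDerivAt (fun x : 𝔼 => 2 * Real.pi * inner ℝ x ξ)
      ((2 * Real.pi) • innerSL ℝ ξ) x := by
    intro x
    have := ((innerSL ℝ ξ).hasFDerivAt (x := x)).const_mul (2 * Real.pi)
    simpa only [innerSL_apply_apply, real_inner_comm] using this
  have hc := hfg.integral_eq hf hg (φ := fun x => Real.cos (2 * Real.pi * inner ℝ x ξ))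
    (contDiff_const.mul (contDiff_id.inner ℝ contDiff_const)).cos
  have hs := hfg.integral_eq hf hg (φ := fun x => Real.sin (2 * Real.pi * inner ℝ x ξ))
    (contDiff_const.mul (contDiff_id.inner ℝ contDiff_const)).sin
  simp only [(hin _).cos.fderiv] at hc
  simp only [(hin _).sin.fderiv] at hs
  have hc' : ∫ x, g x * Real.cos (2 * Real.pi * inner ℝ x ξ) =
      2 * Real.pi * ξ j * ∫ x, f x * Real.sin (2 * Real.pi * inner ℝ x ξ) := by
    rw [← neg_inj, ← hc, ← integral_const_mul, ← integral_neg]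
    congr 1
    ext x
    simp [EuclideanSpace.inner_single_right]
    ring
  have hs' : ∫ x, g x * Real.sin (2 * Real.pi * inner ℝ x ξ) =
      -(2 * Real.pi * ξ j * ∫ x, f x * Real.cos (2 * Real.pi * inner ℝ x ξ)) := by
    rw [← neg_inj, ← hs, neg_neg, ← integral_const_mul]
    congr 1
    ext x
    simp [EuclideanSpace.inner_single_right]
    ring
  rw [hc', hs', derivSymbol]
  push_cast
  linear_combination (2 * Real.pi * ξ j *
    ((∫ x, f x * Real.sin (2 * Real.pi * inner ℝ x ξ) : ℝ) : ℂ)) * Complex.I_sq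

open FourierTransform in
/-- The Fourier integral of a function in `L¹ ∩ L²` is square integrable. -/
theorem memLp_two_fourier {f : 𝔼 → ℂ} (hf1 : Integrable f) (hf2 : MemLp f 2 volume) :
    MemLp (𝓕 f) 2 volume := by
  have hcont : Continuous (𝓕 f) :=
    VectorFourier.fourierIntegral_continuous Real.continuous_fourierChar
      (by exact continuous_inner) hf1
  -- The abstract `L²` transform is square integrable. It agrees almost everywhere with the Fourier
  -- integral since both give the same result against test functions, by moving the transform onto
  -- the test function.
  have hG := Lp.memLp (𝓕 (hf2.toLp f))
  refine hG.ae_eq ?_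
  refine ae_eq_of_integral_contDiff_smul_eq (hG.locallyIntegrable (by norm_num))
    hcont.locallyIntegrable fun φ hφ hc => ?_
  have hg₁ : HasCompactSupport (Complex.ofRealCLM ∘ φ) := hc.comp_left rfl
  have hg₂ : ContDiff ℝ ∞ (Complex.ofRealCLM ∘ φ) := by fun_prop
  let Φ : SchwartzMap 𝔼 ℂ := hg₁.toSchwartzMap hg₂
  have h1 := congrArg (fun T => T Φ) (Lp.fourier_toTemperedDistribution_eq (hf2.toLp f))
  simp only [TemperedDistribution.fourier_apply, Lp.toTemperedDistribution_apply] at h1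
  have h2 : ∫ x, (𝓕 Φ) x • (hf2.toLp f) x = ∫ x, (𝓕 Φ) x • f x :=
    integral_congr_ae (by filter_upwards [hf2.coeFn_toLp] with x hx; rw [hx])
  have h3 := VectorFourier.integral_fourierIntegral_smul_eq_flip (μ := volume) (ν := volume)
    (L := innerₗ 𝔼) Real.continuous_fourierChar continuous_inner Φ.integrable hf1
  have h4 : ∫ x, (𝓕 Φ) x • f x = ∫ x, Φ x • 𝓕 f x := by
    rw [flip_innerₗ] at h3
    exact h3
  have h5 : ∀ x, Φ x = (φ x : ℂ) := fun x => rfl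
  rw [h2, h4] at h1
  simpa [h5] using h1.symm

open FourierTransform in
/-- Fourier inversion almost everywhere. -/
theorem fourierInv_fourier_ae_eq {f : 𝔼 → ℂ} (hf : Integrable f) (hf' : Integrable (𝓕 f)) :
    𝓕⁻ (𝓕 f) =ᵐ[volume] f := by
  have hcont : Continuous (𝓕⁻ (𝓕 f)) :=
    VectorFourier.fourierIntegral_continuous Real.continuous_fourierChar
      (by exact continuous_inner.neg) hf'
  refine ae_eq_of_integral_contDiff_smul_eq hcont.locallyIntegrable hf.locallyIntegrable
    fun φ hφ hc => ?_
  have hg₁ : HasCompactSupport (Complex.ofRealCLM ∘ φ) := hc.comp_left rfl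
  have hg₂ : ContDiff ℝ ∞ (Complex.ofRealCLM ∘ φ) := by fun_prop
  let Φ : SchwartzMap 𝔼 ℂ := hg₁.toSchwartzMap hg₂
  have h5 : ∀ x, Φ x = (φ x : ℂ) := fun x => rfl
  -- Both transforms are moved onto the Schwartz function `Φ`, where inversion holds.
  have h1 := VectorFourier.integral_fourierIntegral_smul_eq_flip (μ := volume) (ν := volume)
    (L := -innerₗ 𝔼) Real.continuous_fourierChar (by exact continuous_inner.neg)
    Φ.integrable hf'
  have h2 := VectorFourier.integral_fourierIntegral_smul_eq_flip (μ := volume) (ν := volume)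
    (L := innerₗ 𝔼) Real.continuous_fourierChar continuous_inner (𝓕⁻ Φ).integrable hf
  have e1 : ∫ x, Φ x • 𝓕⁻ (𝓕 f) x = ∫ x, (𝓕⁻ Φ) x • 𝓕 f x := by
    rw [SchwartzMap.fourierInv_coe]
    refine Eq.trans ?_ h1.symm
    have hflip : (-innerₗ 𝔼).flip = -innerₗ 𝔼 := by
      ext x y
      simp [real_inner_comm]
    rw [hflip]
    rfl
  have e2 : ∫ x, (𝓕⁻ Φ) x • 𝓕 f x = ∫ x, (𝓕 (𝓕⁻ Φ)) x • f x := by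
    refine Eq.trans ?_ h2.symm
    simp only [flip_innerₗ]
    rfl
  rw [FourierTransform.fourier_fourierInv_eq] at e2
  simpa [h5] using e1.trans e2

theorem continuous_realFourier {f : 𝔼 → ℝ} (hf : Integrable f) : Continuous (realFourier f) :=
  VectorFourier.fourierIntegral_continuous Real.continuous_fourierChar
    (by exact continuous_inner) hf.ofReal

/-- Since `‖ξ‖ ≤ ∑ 2π|ξ_j|` and `2π|ξ_j|` times the transform of `f` has the modulus of the
transform of `∂_j f`, one more weight costs one more derivative. -/
theorem CompactSobolev.memLp_weight {k : ℕ} : ∀ {f : 𝔼 → ℝ}, CompactSobolev k f →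
    MemLp (fun ξ => (1 + ‖ξ‖) ^ k * ‖realFourier f ξ‖) 2 volume := by
  induction k with
  | zero =>
    intro f hf
    simp only [pow_zero, one_mul]
    exact (memLp_two_fourier
      (integrable_of_hasCompactSupport_of_memLp hf.1 hf.2).ofReal hf.2.ofReal).norm
  | succ k ih =>
    intro f hf
    choose g hg hfg using hf.2
    have h1 := ih hf.of_succ
    have h2 := memLp_finsetSum Finset.univ fun j _ => ih (hg j)
    refine (h1.add h2).mono' ?_ (Eventually.of_forall fun ξ => ?_)
    · have := continuous_realFourier (integrable_of_hasCompactSupport_of_memLp hf.1.1 hf.1.2)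
      exact Continuous.aestronglyMeasurable (by fun_prop)
    · have hg' : ∀ j, ‖realFourier (g j) ξ‖ = 2 * Real.pi * |ξ j| * ‖realFourier f ξ‖ := by
        intro j
        rw [(hfg j).realFourier_eq hf.1.1 hf.1.2 (hg j).base.1 (hg j).base.2, norm_mul, derivSymbol,
          norm_mul, Complex.norm_I, mul_one, Complex.norm_real, Real.norm_eq_abs, abs_mul,
          abs_of_nonneg (by positivity)]
      have hξ : ‖ξ‖ ≤ ∑ j, 2 * Real.pi * |ξ j| := by
        have h1 : ‖ξ‖ ≤ ∑ j, |ξ j| := by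
          conv_lhs => rw [← (EuclideanSpace.basisFun (Fin n) ℝ).sum_repr ξ]
          refine (norm_sum_le _ _).trans_eq (Finset.sum_congr rfl fun j _ => ?_)
          simp [norm_smul]
        refine h1.trans (Finset.sum_le_sum fun j _ => ?_)
        exact le_mul_of_one_le_left (abs_nonneg _) (by linarith [Real.pi_gt_three])
      simp only [Pi.add_apply, hg']
      rw [Real.norm_of_nonneg (by positivity)]
      calc (1 + ‖ξ‖) ^ (k + 1) * ‖realFourier f ξ‖
          = (1 + ‖ξ‖) ^ k * ‖realFourier f ξ‖ +
            ‖ξ‖ * ((1 + ‖ξ‖) ^ k * ‖realFourier f ξ‖) := by ring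
        _ ≤ (1 + ‖ξ‖) ^ k * ‖realFourier f ξ‖ +
            (∑ j, 2 * Real.pi * |ξ j|) * ((1 + ‖ξ‖) ^ k * ‖realFourier f ξ‖) := by gcongr
        _ = _ := by
            rw [Finset.sum_mul]
            congr 1
            exact Finset.sum_congr rfl fun j _ => by ring

/-- Cauchy–Schwarz against `(1 + ‖ξ‖) ^ (-(⌊n/2⌋ + 1))`, which is square integrable because `2(⌊n/2⌋
+ 1) > n`. -/
theorem CompactSobolev.integrable_weight {m k : ℕ} (hk : m + n / 2 + 1 ≤ k) {f : 𝔼 → ℝ}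
    (hf : CompactSobolev k f) : Integrable fun ξ => (1 + ‖ξ‖) ^ m * ‖realFourier f ξ‖ := by
  have h1 : MemLp (fun ξ : 𝔼 => ((1 + ‖ξ‖) ^ (n / 2 + 1))⁻¹) 2 volume := by
    have hc : Continuous fun ξ : 𝔼 => ((1 + ‖ξ‖) ^ (n / 2 + 1))⁻¹ :=
      Continuous.inv₀ (by fun_prop) fun ξ => by positivity
    rw [memLp_two_iff_integrable_sq hc.aestronglyMeasurable]
    have h := integrable_one_add_norm (E := 𝔼) (μ := volume) (r := ((2 * (n / 2 + 1) : ℕ) : ℝ))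
      (by rw [finrank_euclideanSpace_fin, Nat.cast_lt]; omega)
    refine h.congr (Eventually.of_forall fun ξ => ?_)
    simp only
    rw [Real.rpow_neg (by positivity), Real.rpow_natCast, inv_pow, ← pow_mul, mul_comm]
  refine (hf.memLp_weight.integrable_mul h1).mono' ?_ (Eventually.of_forall fun ξ => ?_)
  · have := continuous_realFourier
      (integrable_of_hasCompactSupport_of_memLp hf.base.1 hf.base.2)
    exact Continuous.aestronglyMeasurable (by fun_prop)
  · rw [Real.norm_of_nonneg (by positivity), Pi.mul_apply, ← div_eq_mul_inv,
      le_div_iff₀ (by positivity), mul_right_comm, ← pow_add]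
    gcongr
    · linarith [norm_nonneg ξ]
    · omega

theorem ae_re_integral_planeWave_realFourier {f : 𝔼 → ℝ} (hf : Integrable f)
    (hf' : Integrable (realFourier f)) :
    ∀ᵐ x, (∫ ξ, planeWave ξ x * realFourier f ξ).re = f x := by
  filter_upwards [fourierInv_fourier_ae_eq hf.ofReal hf'] with x hx
  rw [Real.fourierInv_eq'] at hx
  have := congrArg Complex.re hx
  simpa [planeWave, realFourier] using this

theorem CompactSobolev.integrable {k : ℕ} {f : 𝔼 → ℝ} (hf : CompactSobolev k f) :
    Integrable f :=
  integrable_of_hasCompactSupport_of_memLp hf.base.1 hf.base.2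

theorem CompactSobolev.integrable_realFourier {k : ℕ} (hk : n / 2 + 1 ≤ k) {f : 𝔼 → ℝ}
    (hf : CompactSobolev k f) : Integrable (realFourier f) := by
  have h := hf.integrable_weight (m := 0) (by omega)
  simp only [pow_zero, one_mul] at h
  exact (integrable_norm_iff (continuous_realFourier hf.integrable).aestronglyMeasurable).1 h

/-! ### Local solutions and gluing -/

/-- Solutions of the wave equation with prescribed Cauchy data on a ball. -/
theorem exists_wave_solution_on_ball {u₀ u₁ : 𝔼 → ℝ} (h₀ : LocalSobolev (2 + n / 2 + 1) u₀)
    (h₁ : LocalSobolev (1 + n / 2 + 1) u₁) (R : ℝ) :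
    ∃ u : 𝔼 × ℝ → ℝ, ContDiff ℝ 2 u ∧ (∀ p, waveOperator u p = 0) ∧
      (∀ᵐ x, ‖x‖ < R → u (x, 0) = u₀ x) ∧
      ∀ᵐ x, ‖x‖ < R → deriv (fun t => u (x, t)) 0 = u₁ x := by
  obtain ⟨ψ, hψ, hψc, hψ1⟩ := exists_smooth_cutoff (n := n) R
  have hf := h₀.mul_cutoff hψ hψc
  have hg := h₁.mul_cutoff hψ hψc
  obtain ⟨u, hu, hw, hu0, hu1⟩ := exists_wave_solution_of_fourier
    (continuous_realFourier hf.integrable).aestronglyMeasurable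
    (continuous_realFourier hg.integrable).aestronglyMeasurable
    (hf.integrable_weight (m := 2) le_rfl)
    (by simpa only [pow_one] using hg.integrable_weight (m := 1) le_rfl)
  refine ⟨u, hu, hw, ?_, ?_⟩
  · filter_upwards [ae_re_integral_planeWave_realFourier hf.integrable
      (hf.integrable_realFourier (by omega))] with x hx hxR
    rw [hu0, hx, hψ1 x hxR, one_mul]
  · filter_upwards [ae_re_integral_planeWave_realFourier hg.integrable
      (hg.integrable_realFourier (by omega))] with x hx hxR
    rw [hu1, hx, hψ1 x hxR, one_mul]

theorem waveOperator_sub {u v : 𝔼 × ℝ → ℝ} (hu : ContDiff ℝ 2 u) (hv : ContDiff ℝ 2 v)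
    (p : 𝔼 × ℝ) :
    waveOperator (fun q => u q - v q) p = waveOperator u p - waveOperator v p := by
  have h1 : ∀ w, (fun q => fderiv ℝ (fun q => u q - v q) q w) =
      fun q => fderiv ℝ u q w - fderiv ℝ v q w := by
    intro w
    ext q
    rw [fderiv_fun_sub (hu.differentiable two_ne_zero q) (hv.differentiable two_ne_zero q)]
    rfl
  have h2 : ∀ w, fderiv ℝ (fun q => fderiv ℝ (fun q => u q - v q) q w) p w =
      fderiv ℝ (fun q => fderiv ℝ u q w) p w - fderiv ℝ (fun q => fderiv ℝ v q w) p w := by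
    intro w
    rw [h1, fderiv_fun_sub ((hu.fderiv_apply_const w).differentiable one_ne_zero p)
      ((hv.fderiv_apply_const w).differentiable one_ne_zero p)]
    rfl
  rw [waveOperator_eq_fderiv (hu.sub hv), waveOperator_eq_fderiv hu, waveOperator_eq_fderiv hv]
  simp only [h2, Finset.sum_sub_distrib]
  ring

/-- Uniqueness in the domain of dependence, for Cauchy data prescribed almost everywhere. -/
theorem wave_solution_unique {u v : 𝔼 × ℝ → ℝ} {u₀ u₁ : 𝔼 → ℝ} {R : ℝ} (hu : ContDiff ℝ 2 u)
    (hv : ContDiff ℝ 2 v) (hwu : ∀ p, waveOperator u p = 0) (hwv : ∀ p, waveOperator v p = 0)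
    (hu0 : ∀ᵐ x, ‖x‖ < R → u (x, 0) = u₀ x) (hv0 : ∀ᵐ x, ‖x‖ < R → v (x, 0) = u₀ x)
    (hu1 : ∀ᵐ x, ‖x‖ < R → deriv (fun t => u (x, t)) 0 = u₁ x)
    (hv1 : ∀ᵐ x, ‖x‖ < R → deriv (fun t => v (x, t)) 0 = u₁ x)
    {p : 𝔼 × ℝ} (hp : ‖p.1‖ + |p.2| < R) : u p = v p := by
  have hopen : IsOpen {x : 𝔼 | ‖x‖ < R} := isOpen_lt continuous_norm continuous_const
  have hdu : Differentiable ℝ u := hu.differentiable two_ne_zero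
  have hdv : Differentiable ℝ v := hv.differentiable two_ne_zero
  have hl : Continuous fun x : 𝔼 => (x, (0 : ℝ)) := by fun_prop
  -- Continuous functions that agree almost everywhere on an open set agree everywhere on it, so the
  -- classical uniqueness result applies.
  have e0 : EqOn (fun x => u (x, 0)) (fun x => v (x, 0)) {x : 𝔼 | ‖x‖ < R} := by
    refine Measure.eqOn_open_of_ae_eq (μ := volume) ?_ hopen
      (hu.continuous.comp hl).continuousOn (hv.continuous.comp hl).continuousOn
    rw [EventuallyEq, ae_restrict_iff' hopen.measurableSet]
    filter_upwards [hu0, hv0] with x h1 h2 hx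
    rw [h1 hx, h2 hx]
  have e1 : EqOn (fun x => fderiv ℝ u (x, 0) (0, 1)) (fun x => fderiv ℝ v (x, 0) (0, 1))
      {x : 𝔼 | ‖x‖ < R} := by
    refine Measure.eqOn_open_of_ae_eq (μ := volume) ?_ hopen
      ((hu.fderiv_apply_const _).continuous.comp hl).continuousOn
      ((hv.fderiv_apply_const _).continuous.comp hl).continuousOn
    rw [EventuallyEq, ae_restrict_iff' hopen.measurableSet]
    filter_upwards [hu1, hv1] with x h1 h2 hx
    rw [← (hasDerivAt_slice_snd (hdu (x, 0))).deriv, ← (hasDerivAt_slice_snd (hdv (x, 0))).deriv,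
      h1 hx, h2 hx]
  have := eq_zero_of_cauchyData_eq_zero (w := fun q => u q - v q) (R := R) (hu.sub hv)
    (fun p => by rw [waveOperator_sub hu hv, hwu, hwv, sub_zero])
    (fun x hx => sub_eq_zero.2 (e0 hx))
    (fun x hx => by
      rw [fderiv_fun_sub (hdu _) (hdv _)]
      exact sub_eq_zero.2 (e1 hx)) (x := p.1) (t := p.2) hp
  exact sub_eq_zero.1 this

theorem waveOperator_congr {u v : 𝔼 × ℝ → ℝ} {p : 𝔼 × ℝ} (h : u =ᶠ[𝓝 p] v) :
    waveOperator u p = waveOperator v p := by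
  have h1 : (fun y => u (y, p.2)) =ᶠ[𝓝 p.1] fun y => v (y, p.2) :=
    (Continuous.tendsto (by fun_prop : Continuous fun y : 𝔼 => (y, p.2)) p.1).eventually h
  have h2 : (fun s => u (p.1, s)) =ᶠ[𝓝 p.2] fun s => v (p.1, s) :=
    (Continuous.tendsto (by fun_prop : Continuous fun s : ℝ => (p.1, s)) p.2).eventually h
  unfold waveOperator
  rw [(laplacian_congr_nhds h1).eq_of_nhds, h2.iteratedDeriv_eq 2]

theorem mainTheorem10 (n : ℕ) (u₀ u₁ : EuclideanSpace ℝ (Fin n) → ℝ)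
    (h₀ : HasSquareIntegrableDerivativesUpTo ((n : ℝ) / 2 + 3) u₀)
    (h₁ : HasSquareIntegrableDerivativesUpTo ((n : ℝ) / 2 + 2) u₁) :
    ∃ u : EuclideanSpace ℝ (Fin n) × ℝ → ℝ,
      ContDiff ℝ 2 u ∧
      (∀ p, waveOperator u p = 0) ∧
      (fun x => u (x, 0)) =ᵐ[volume] u₀ ∧
      (fun x => deriv (fun t => u (x, t)) 0) =ᵐ[volume] u₁ := by
  -- The Sobolev orders use `⌊n/2⌋`, the hypotheses the real number `n/2`.
  have hn : ((n / 2 : ℕ) : ℝ) ≤ (n : ℝ) / 2 := by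
    simpa using Nat.cast_div_le (α := ℝ) (m := n) (n := 2)
  have hs₀ : LocalSobolev (2 + n / 2 + 1) u₀ := h₀.localSobolev (by push_cast; linarith)
  have hs₁ : LocalSobolev (1 + n / 2 + 1) u₁ := h₁.localSobolev (by push_cast; linarith)
  choose U hU hw hU0 hU1 using fun N : ℕ => exists_wave_solution_on_ball hs₀ hs₁ N
  -- The added 1 makes the radius strictly larger than `‖x‖ + |t|`, so a neighbourhood of the point
  -- stays in the same double cone.
  set u : EuclideanSpace ℝ (Fin n) × ℝ → ℝ := fun p => U (⌈‖p.1‖ + |p.2|⌉₊ + 1) p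
  have hceil : ∀ p : EuclideanSpace ℝ (Fin n) × ℝ,
      ‖p.1‖ + |p.2| < ((⌈‖p.1‖ + |p.2|⌉₊ + 1 : ℕ) : ℝ) := fun p => by
    push_cast
    linarith [Nat.le_ceil (‖p.1‖ + |p.2|)]
  have huU : ∀ (N : ℕ) (p : EuclideanSpace ℝ (Fin n) × ℝ), ‖p.1‖ + |p.2| < N → u p = U N p := by
    intro N p hp
    set M := ⌈‖p.1‖ + |p.2|⌉₊ + 1
    refine wave_solution_unique (R := min (M : ℝ) N) (hU M) (hU N) (hw M) (hw N) (u₀ := u₀)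
      (u₁ := u₁) ?_ ?_ ?_ ?_ (lt_min (hceil p) hp)
    · filter_upwards [hU0 M] with x hx h using hx (h.trans_le (min_le_left _ _))
    · filter_upwards [hU0 N] with x hx h using hx (h.trans_le (min_le_right _ _))
    · filter_upwards [hU1 M] with x hx h using hx (h.trans_le (min_le_left _ _))
    · filter_upwards [hU1 N] with x hx h using hx (h.trans_le (min_le_right _ _))
  have hloc : ∀ (N : ℕ) (p : EuclideanSpace ℝ (Fin n) × ℝ), ‖p.1‖ + |p.2| < N →
      u =ᶠ[𝓝 p] U N := by
    intro N p hp
    filter_upwards [(isOpen_lt (by fun_prop : Continuous fun p : EuclideanSpace ℝ (Fin n) × ℝ =>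
      ‖p.1‖ + |p.2|) continuous_const).mem_nhds hp] with q hq
    exact huU N q hq
  refine ⟨u, ?_, fun p => ?_, ?_, ?_⟩
  · rw [contDiff_iff_contDiffAt]
    exact fun p => ((hU _).contDiffAt).congr_of_eventuallyEq (hloc _ p (hceil p))
  · rw [waveOperator_congr (hloc _ p (hceil p)), hw]
  -- The index of the local solution depends on `x`, so a single null set must serve all of the
  -- countably many indices.
  · filter_upwards [ae_all_iff.2 hU0] with x hx
    refine hx _ ?_
    simpa using hceil (x, 0)
  · filter_upwards [ae_all_iff.2 hU1] with x hx
    have h := hloc _ (x, 0) (hceil (x, 0))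
    have h2 : (fun t => u (x, t)) =ᶠ[𝓝 0] fun t => U (⌈‖x‖ + |0|⌉₊ + 1) (x, t) :=
      (Continuous.tendsto (by fun_prop : Continuous fun s : ℝ => (x, s)) 0).eventually h
    rw [h2.deriv_eq]
    refine hx _ ?_
    simpa using hceil (x, 0)
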